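/- For each $n\in\mathbb N$, $n\ge 1$, consider an $M_t/M_t/K_t+M_t$ queue. Let $\lambda^n,\theta,\mu:[0,\infty)\to[0,\infty)$ be locally integrable (integrable on $[0,t]$ for every $t$) and let $K^n:[0,\infty)\to[0,\infty)$ (the number of servers) be Lebesgue measurable and bounded on bounded intervals. A Poisson process of rate $r_t$ is a process with nondecreasing, right-continuous, $\mathbb Z_{\ge 0}$-valued paths starting at $0$ that has independent increments, the increment over $(s,t]$ being Poisson distributed with mean $\int_s^t r_u\,du$. On a probability space $(\Omega,\mathcal F,\mathbf P)$ let, for each $n$, the $\mathbb Z_{\ge 0}$-valued random variable $Q^n_0$ (initial number of customers), the Poisson process $A^n$ of rate $\lambda^n_t$ (arrivals), the Poisson processes $R^{n,i}$, $i\ge 1$, of rate $\theta_t$ (abandonments) and the Poisson processes $B^{n,i}$, $i\ge 1$, of rate $\mu_t$ (services) be mutually independent. Let the number of customers $Q^n=(Q^n_t,\,t\ge 0)$ be a $\mathbb Z_{\ge 0}$-valued process whose paths are right-continuous with left-hand limits and which satisfies, almost surely for all $t\ge 0$, $$Q^n_t=Q^n_0+A^n_t-\sum_{i=1}^\infty\int_{(0,t]}\mathbf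 1_{\{Q^n_{s-}\ge K^n_{s-}+i\}}\,dR^{n,i}_s-\sum_{i=1}^\infty\int_{(0,t]}\mathbf 1_{\{Q^n_{s-}\wedge K^n_{s-}\ge i\}}\,dB^{n,i}_s ,$$ where $x_{s-}$ denotes the left-hand limit at $s$ (and $K^n_{s-}$ is read as $K^n_s$ at a time $s$ at which $K^n$ has no left-hand limit). Suppose that $Q^n_0/n$ converges in probability to a constant $q_0$ as $n\to\infty$; that $\int_0^t\lambda^n_s/n\,ds\to\int_0^t\lambda_s\,ds$ for all $t\ge 0$, where $\lambda:[0,\infty)\to[0,\infty)$ is locally integrable; and that $K^n_t/n\to k_t$ uniformly on bounded intervals of $t$, where $k:[0,\infty)\to[0,\infty)$ is locally bounded and Lebesgue measurable. Then the integral equation $$q_t=q_0+\int_0^t\lambda_s\,ds-\int_0^t\theta_s(q_s-k_s)^+\,ds-\int_0^t\mu_s\,(q_s\wedge k_s)\,ds,\qquad t\ge 0,$$ has a unique solution $q:[0,\infty)\to\mathbb R$ (a solution being a function for which the last two integrands are locally integrable and the equation holds), and for all $T>0$ and $\epsilon>0$, $$\lim_{n\to\infty}\mathbf P\Bigl(\sup_{t\in[0,T]}\Bigl|\frac{Q^n_t}{n}-q_t\Bigr|>\epsilon\Bigr)=0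 .$$ -/

import Mathlib

open MeasureTheory ProbabilityTheory Filter Set Topology
open scoped NNReal ENNReal

namespace FluidQueue

/-- A path of a counting process on `[0, ∞)`: an `ℕ`-valued, nondecreasing, right-continuous
function that starts at `0`. -/
structure CountingPath where
  toFun : ℝ≥0 → ℕ
  map_zero : toFun 0 = 0
  mono : Monotone toFun
  right_cont : ∀ t, ContinuousWithinAt toFun (Ici t) t

instance : CoeFun CountingPath (fun _ => ℝ≥0 → ℕ) := ⟨CountingPath.toFun⟩

/-- A counting path as a real-valued Stieltjes function on `[0, ∞)`. -/
def CountingPath.stieltjes (x : CountingPath) : StieltjesFunction ℝ≥0 where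
  toFun t := (x t : ℝ)
  mono' _ _ h := Nat.cast_le.2 (x.mono h)
  right_continuous' t :=
    (continuous_of_discreteTopology (f := fun m : ℕ => (m : ℝ))).continuousAt.comp_continuousWithinAt
      (x.right_cont t)

/-- `x.integralOn t E` is the Lebesgue-Stieltjes integral `∫_(0,t] 1_E(s) dx_s`. -/
noncomputable def CountingPath.integralOn (x : CountingPath) (t : ℝ≥0) (E : Set ℝ≥0) : ℝ≥0∞ :=
  x.stieltjes.measure (Ioc 0 t ∩ E)

/-- Real paths on `[0, ∞)` that are right-continuous with left-hand limits. -/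
def IsCadlag (f : ℝ≥0 → ℝ) : Prop :=
  ∀ t, ContinuousWithinAt f (Ici t) t ∧ ∃ l, Tendsto f (𝓝[<] t) (𝓝 l)

/-- Lebesgue measure on `[0, ∞)`. -/
noncomputable def leb : Measure ℝ≥0 :=
  Measure.comap ((↑) : ℝ≥0 → ℝ) volume

/-- A function on `[0, ∞)` with `∫_0^t |r_s| ds < ∞` for all `t`. -/
def LocIntegrable (r : ℝ≥0 → ℝ) : Prop :=
  ∀ t, IntegrableOn r (Iic t) leb

/-- Nonnegative, Lebesgue measurable, bounded on bounded intervals. -/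
structure IsStaffing (K : ℝ≥0 → ℝ) : Prop where
  nonneg : ∀ t, 0 ≤ K t
  measurable : AEMeasurable K leb
  bounded : ∀ t, BddAbove (K '' Iic t)

section Probability

variable {Ω : Type*} [MeasurableSpace Ω]

/-- `N` is a Poisson process with (time-dependent) rate `r`: it has independent increments, and
`N_t - N_s` is Poisson distributed with mean `∫_s^t r_u du`. -/
structure IsPoissonProcess (N : Ω → CountingPath) (r : ℝ≥0 → ℝ) (P : Measure Ω) : Prop where
  measurable : ∀ t, Measurable (fun ω => N ω t)
  indep_increments : HasIndepIncrements (fun t ω => N ω t) P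
  law : ∀ s t, s ≤ t →
    HasLaw (fun ω => N ω t - N ω s) (poissonMeasure (∫ u in Ioc s t, r u ∂leb).toNNReal) P

/-- The `σ`-algebra generated by a random counting path. -/
@[reducible] def pathSigma (N : Ω → CountingPath) : MeasurableSpace Ω :=
  ⨆ t, MeasurableSpace.comap (fun ω => N ω t) ⊤

/-- Labels of the primitive random objects of a queue. -/
inductive Source where
  | initial : Source
  | arrival : Source
  | abandonment (i : ℕ) : Source
  | service (i : ℕ) : Source

/-- The `σ`-algebras generated by the primitive random objects: the initial number of customers
`Q₀`, the arrival process `A`, the processes `R i` and the processes `B i`. -/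
@[reducible] def sourceSigma (Q₀ : Ω → ℕ) (A : Ω → CountingPath) (R B : ℕ → Ω → CountingPath) :
    Source → MeasurableSpace Ω
  | .initial => MeasurableSpace.comap Q₀ ⊤
  | .arrival => pathSigma A
  | .abandonment i => pathSigma (R i)
  | .service i => pathSigma (B i)

/-- The left-hand limit `Q_{s-}` of the path of `Q` at `ω`. -/
noncomputable def leftQ (Q : ℝ≥0 → Ω → ℕ) (ω : Ω) (s : ℝ≥0) : ℝ :=
  Function.leftLim (fun u => (Q u ω : ℝ)) s

/-- The number of customers who have abandoned the queue by time `t`,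
`∑_{i ≥ 1} ∫_(0,t] 1(Q_{s-} ≥ K_{s-} + i) dR^i_s`; the processes `R^1, R^2, …` are
`R 0, R 1, …`. By definition of `Function.leftLim`, `K_{s-}` is read as `K_s` at a
time `s` at which `K` has no left-hand limit. -/
noncomputable def abandonments (K : ℝ≥0 → ℝ) (R : ℕ → Ω → CountingPath) (Q : ℝ≥0 → Ω → ℕ)
    (t : ℝ≥0) (ω : Ω) : ℝ≥0∞ :=
  ∑' i : ℕ, (R i ω).integralOn t {s | Function.leftLim K s + ((i : ℝ) + 1) ≤ leftQ Q ω s}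

/-- The number of customers whose service has been completed by time `t`,
`∑_{i ≥ 1} ∫_(0,t] 1(Q_{s-} ∧ K_{s-} ≥ i) dB^i_s`. -/
noncomputable def completions (K : ℝ≥0 → ℝ) (B : ℕ → Ω → CountingPath) (Q : ℝ≥0 → Ω → ℕ)
    (t : ℝ≥0) (ω : Ω) : ℝ≥0∞ :=
  ∑' i : ℕ, (B i ω).integralOn t {s | (i : ℝ) + 1 ≤ min (leftQ Q ω s) (Function.leftLim K s)}

/-- `Q` is the number-of-customers process of the `M_t/M_t/K_t + M_t` queue with arrival rate `lam`,
service rate `mu`, abandonment rate `theta` and `K_t` servers, driven by `A`, `R`, `B`. -/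
structure IsQueue (P : Measure Ω) (lam theta mu K : ℝ≥0 → ℝ)
    (A : Ω → CountingPath) (R B : ℕ → Ω → CountingPath) (Q : ℝ≥0 → Ω → ℕ) : Prop where
  arrival : IsPoissonProcess A lam P
  abandonment : ∀ i, IsPoissonProcess (R i) theta P
  service : ∀ i, IsPoissonProcess (B i) mu P
  indep : iIndep (sourceSigma (Q 0) A R B) P
  measurable : ∀ t, Measurable (Q t)
  cadlag : ∀ ω, IsCadlag (fun t => (Q t ω : ℝ))
  /-- `Q_t = Q_0 + A_t - (abandonments by time t) - (service completions by time t)`, with the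
  subtracted terms moved to the left-hand side. -/
  balance : ∀ᵐ ω ∂P, ∀ t,
    (Q t ω : ℝ≥0∞) + abandonments K R Q t ω + completions K B Q t ω = Q 0 ω + A ω t

end Probability

/-- `q` solves
`q_t = q_0 + ∫_0^t λ_s ds - ∫_0^t θ_s (q_s - k_s)^+ ds - ∫_0^t μ_s (q_s ∧ k_s) ds`, the integrals
being finite. -/
structure IsFluidSolution (q₀ : ℝ) (lam theta mu k q : ℝ≥0 → ℝ) : Prop where
  integrable_abandonment : LocIntegrable (fun s => theta s * max (q s - k s) 0)
  integrable_service : LocIntegrable (fun s => mu s * min (q s) (k s))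
  equation : ∀ t, q t = q₀ + (∫ s in Iic t, lam s ∂leb)
    - (∫ s in Iic t, theta s * max (q s - k s) 0 ∂leb)
    - ∫ s in Iic t, mu s * min (q s) (k s) ∂leb

end FluidQueue

namespace FluidQueue

/-! ### Measures on the half-line -/

/-! Write x = Qⁿ/n and let F be the right-hand side of the integral equation. Since (y - κ)⁺ and min
y κ are 1-Lipschitz in y, F is Lipschitz with respect to the atomless measure (θ + μ) ds, and
Gronwall's inequality (`exists_gronwall_const`) shows that two functions whose residuals x - F x are
small on [0, T] are close there (`exists_fluid_stability_const`). Uniqueness is the case of zero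
residuals, and convergence follows once the residual of Qⁿ/n is small with probability tending to 1
(`IsFluidRegime.eventually_residual_le`). Existence comes from the same estimate: an event of
positive probability is nonempty, so paths of the rescaled queues are approximate solutions with
residuals tending to zero; by stability they are locally uniformly Cauchy, and their limit solves
the equation.

The residual is estimated without martingales. If the number of active clocks is a deterministic
function of time, the total count is a sum of independent counts of Poisson points in deterministic
sets. Their means and variances come from moment formulas for the jump measure, and Chebyshev's
inequality gives a law of large numbers (`thinned_law_of_large_numbers`). The actual number of
active clocks depends on the random state, but monotonically. On a short interval the state moves by
at most δ with high probability: it rises at most by the arrivals and falls at most by the jumps of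
about n M clocks of each family (`IsFluidRegime.eventually_oscillation`). The true count is thus
squeezed between the counts at two levels of a finite deterministic grid
(`IsPoissonFamily.eventually_thinned`). Summing over finitely many short intervals controls the
residual at their endpoints, and small oscillation controls it in between. -/

instance : NullSingletonClass leb where
  measure_singleton x := by
    rw [leb, Measure.comap_apply _ NNReal.coe_injective _ _ (measurableSet_singleton x)]
    · simp
    · intro s hs
      exact (MeasurableEmbedding.subtype_coe measurableSet_Ici).measurableSet_image.2 hs

/-- A function with values in the reals agrees with its left limits off a countable set. -/
theorem countable_leftLim_ne (f : ℝ≥0 → ℝ) : {s | Function.leftLim f s ≠ f s}.Countable := by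
  -- A left limit that differs from the value leaves a gap below or above f s on some (a, s) with a
  -- rational. For each fixed a, the points with such a gap are countable.
  refine Countable.mono (s₂ := ⋃ a : ℚ,
    ({x ∈ Ioi (Real.toNNReal a) | ∃ z, f x < z ∧ ∀ y ∈ Ioi (Real.toNNReal a), y < x → z ≤ f y} ∪
     {x ∈ Ioi (Real.toNNReal a) | ∃ z, z < f x ∧ ∀ y ∈ Ioi (Real.toNNReal a), y < x → f y ≤ z}))
    ?_ (countable_iUnion fun a => Countable.union
      (countable_image_gt_image_Iio_within _ f)
      (countable_image_lt_image_Iio_within _ f))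
  intro s hs
  by_cases hbot : 𝓝[<] s = ⊥
  · exact absurd (leftLim_eq_of_eq_bot f hbot) hs
  have : (𝓝[<] s).NeBot := ⟨hbot⟩
  by_cases hlim : ∃ y, Tendsto f (𝓝[<] s) (𝓝 y)
  swap
  · refine absurd ?_ hs
    exact leftLim_eq_of_not_tendsto f hlim
  obtain ⟨y, hy⟩ := hlim
  have hys : y ≠ f s := by
    rw [← leftLim_eq_of_tendsto hy]
    exact hs
  have hs0 : 0 < s := by
    rcases eq_zero_or_pos s with rfl | h
    · exact absurd (by simp) hbot
    · exact h
  have key : ∀ p : ℝ → Prop, (∀ᶠ t in 𝓝[<] s, p (f t)) →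
      ∃ a : ℚ, Real.toNNReal a < s ∧ ∀ t, Real.toNNReal a < t → t < s → p (f t) := by
    intro p hp
    obtain ⟨l, hl, hl'⟩ := (mem_nhdsLT_iff_exists_Ioo_subset' hs0).1 hp
    obtain ⟨a, ha1, ha2⟩ := exists_rat_btwn (NNReal.coe_lt_coe.2 hl)
    have ha0 : (0 : ℝ) ≤ a := l.2.trans ha1.le
    refine ⟨a, (Real.toNNReal_lt_iff_lt_coe ha0).2 ha2, fun t ht hts => hl' ⟨lt_trans ?_ ht, hts⟩⟩
    exact Real.lt_toNNReal_iff_coe_lt.2 ha1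
  rw [mem_iUnion]
  rcases lt_or_gt_of_ne hys with h | h
  · obtain ⟨z, hz1, hz2⟩ := exists_between h
    obtain ⟨a, ha1, ha2⟩ := key (fun v => v ≤ z) (hy.eventually (Iic_mem_nhds hz1))
    exact ⟨a, Or.inr ⟨ha1, z, hz2, fun t ht hts => ha2 t ht hts⟩⟩
  · obtain ⟨z, hz1, hz2⟩ := exists_between h
    obtain ⟨a, ha1, ha2⟩ := key (fun v => z ≤ v) (hy.eventually (Ici_mem_nhds hz2))
    exact ⟨a, Or.inl ⟨ha1, z, hz1, fun t ht hts => ha2 t ht hts⟩⟩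

theorem ae_leftLim_eq (f : ℝ≥0 → ℝ) : ∀ᵐ s ∂leb, Function.leftLim f s = f s :=
  (countable_leftLim_ne f).measure_zero leb

theorem continuous_measure_Iic (ρ : Measure ℝ≥0) [NullSingletonClass ρ] (hρ : ∀ t, ρ (Iic t) ≠ ∞) :
    Continuous fun t => ρ (Iic t) := by
  refine continuous_iff_continuousAt.2 fun t => ?_
  refine tendsto_measure_of_ae_tendsto_indicator (𝓝 t) measurableSet_Iic
    (fun _ => measurableSet_Iic) (measurableSet_Iic (a := t + 1)) (hρ _) ?_ ?_
  · filter_upwards [Iic_mem_nhds (show t < t + 1 by simp)] with s hs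
    exact Iic_subset_Iic.2 hs
  · filter_upwards [compl_mem_ae_iff.2 (measure_singleton (μ := ρ) t)] with x hx
    rcases lt_or_gt_of_ne (show x ≠ t from hx) with h | h
    · filter_upwards [Ioi_mem_nhds h] with s hs
      simp [h.le, (show x < s from hs).le]
    · filter_upwards [Iio_mem_nhds h] with s hs
      simp [not_le.2 h, not_le.2 (show s < x from hs)]

theorem measure_Ioc_toReal {ρ : Measure ℝ≥0} (hρ : ∀ t, ρ (Iic t) ≠ ∞) {a b : ℝ≥0} (hab : a ≤ b) :
    (ρ (Ioc a b)).toReal = (ρ (Iic b)).toReal - (ρ (Iic a)).toReal := by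
  have h : ρ (Iic b) = ρ (Iic a) + ρ (Ioc a b) := by
    rw [← measure_union (Iic_disjoint_Ioc le_rfl) measurableSet_Ioc, Iic_union_Ioc_eq_Iic hab]
  have h2 : ρ (Ioc a b) ≠ ∞ := measure_ne_top_of_subset Ioc_subset_Iic_self (hρ b)
  rw [h, ENNReal.toReal_add (hρ a) h2]
  ring

/-- A bounded interval can be cut into finitely many pieces of small mass. -/
theorem exists_partition (ρ : Measure ℝ≥0) [NullSingletonClass ρ]
    (hρ : ∀ t, ρ (Iic t) ≠ ∞) (T : ℝ≥0)
    {δ : ℝ} (hδ : 0 < δ) :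
    ∃ (m : ℕ) (τ : ℕ → ℝ≥0), Monotone τ ∧ τ 0 = 0 ∧ τ m = T ∧
      ∀ j < m, (ρ (Ioc (τ j) (τ (j + 1)))).toReal ≤ δ := by
  have hcont : Continuous fun t => (ρ (Iic t)).toReal :=
    continuous_iff_continuousAt.2 fun t =>
      (ENNReal.tendsto_toReal (hρ t)).comp (continuous_measure_Iic ρ hρ).continuousAt
  have hu := (isCompact_Icc (a := (0 : ℝ≥0)) (b := T)).uniformContinuousOn_of_continuous
    hcont.continuousOn
  obtain ⟨η, hη, hη'⟩ := Metric.uniformContinuousOn_iff.1 hu δ hδ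
  -- Equal spacing T / m < η suffices, by uniform continuity of the distribution function.
  obtain ⟨m, hm⟩ := exists_nat_gt ((T : ℝ) / η)
  have hm0 : 0 < m := by
    have : (0 : ℝ) < m := lt_of_le_of_lt (by positivity) hm
    exact_mod_cast this
  have hm0' : (0 : ℝ≥0) < m := by exact_mod_cast hm0
  have hle : ∀ j ≤ m, (j : ℝ≥0) * (T / m) ≤ T := fun j hj => by
    calc (j : ℝ≥0) * (T / m) ≤ m * (T / m) := by gcongr
      _ = T := by field_simp
  have hmono : Monotone fun j : ℕ => (j : ℝ≥0) * (T / m) := fun i j h => by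
    dsimp only
    gcongr
  refine ⟨m, fun j => j * (T / m), hmono, by simp, by field_simp, fun j hj => ?_⟩
  rw [measure_Ioc_toReal hρ (hmono j.le_succ)]
  refine (le_abs_self _).trans ?_
  rw [← Real.dist_eq]
  refine (hη' _ ⟨zero_le, hle _ hj⟩ _ ⟨zero_le, hle _ hj.le⟩ ?_).le
  rw [NNReal.dist_eq]
  push_cast
  rw [show ((j : ℝ) + 1) * (T / m) - j * (T / m) = T / m by ring, abs_of_nonneg (by positivity)]
  rw [div_lt_iff₀ hη] at hm
  rw [div_lt_iff₀ (by exact_mod_cast hm0)]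
  linarith

/-- Gronwall's inequality with respect to an atomless measure. -/
theorem exists_gronwall_const (ρ : Measure ℝ≥0) [NullSingletonClass ρ]
    (hρ : ∀ t, ρ (Iic t) ≠ ∞) (T : ℝ≥0) :
    ∃ C : ℝ≥0∞, C ≠ ∞ ∧ ∀ (u : ℝ≥0 → ℝ≥0∞) (e b : ℝ≥0∞), b ≠ ∞ → (∀ t ≤ T, u t ≤ b) →
      (∀ t ≤ T, u t ≤ e + ∫⁻ s in Iic t, u s ∂ρ) → ∀ t ≤ T, u t ≤ C * e := by
  -- On a piece of mass at most 1/2, the integral over the piece is at most half the supremum and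
  -- can be absorbed. No measurability of `u` enters, which matters because fluid solutions are not
  -- assumed measurable.
  obtain ⟨m, τ, hτ, hτ0, hτm, hτδ⟩ := exists_partition ρ hρ T (δ := 1 / 2) (by norm_num)
  have main : ∀ j ≤ m, ∃ C : ℝ≥0∞, C ≠ ∞ ∧ ∀ (u : ℝ≥0 → ℝ≥0∞) (e b : ℝ≥0∞), b ≠ ∞ →
      (∀ t ≤ T, u t ≤ b) → (∀ t ≤ T, u t ≤ e + ∫⁻ s in Iic t, u s ∂ρ) →
      ∀ t ≤ τ j, u t ≤ C * e := by
    intro j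
    induction j with
    | zero =>
      refine fun _ => ⟨1, by simp, fun u e b _ _ h t ht => ?_⟩
      have ht0 : t = 0 := le_antisymm (ht.trans_eq hτ0) zero_le
      have h0 : ρ (Iic (0 : ℝ≥0)) = 0 := by
        rw [show Iic (0 : ℝ≥0) = {0} by ext x; simp]
        exact measure_singleton 0
      have := h t (ht0 ▸ zero_le)
      rwa [ht0, Measure.restrict_eq_zero.2 h0, lintegral_zero_measure, add_zero, ← ht0,
        ← one_mul e] at this
    | succ j ih =>
      intro hj
      obtain ⟨C, hC, hC'⟩ := ih (by omega)
      have hτT : τ (j + 1) ≤ T := hτm ▸ hτ hj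
      refine ⟨C + 2 * (1 + C * ρ (Iic T)), by finiteness [hρ T], fun u e b hb hub h t ht => ?_⟩
      by_cases he : e = ∞
      · subst he
        rw [ENNReal.mul_top (by simp)]
        exact le_top
      -- The a priori bound `b` makes S finite; only then can S / 2 be cancelled below.
      set S := ⨆ t ∈ Iic (τ (j + 1)), u t with hS
      have hSb : S ≠ ∞ := ne_top_of_le_ne_top hb (iSup₂_le fun s hs => hub s (le_trans hs hτT))
      have hstep : S ≤ e * (1 + C * ρ (Iic T)) + S / 2 := by
        refine iSup₂_le fun s hs => ?_
        have hs' : s ≤ τ (j + 1) := hs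
        refine (h s (hs'.trans hτT)).trans ?_
        have h1 : ∫⁻ v in Iic s, u v ∂ρ ≤
            ∫⁻ v in Iic (τ j) ∪ Ioc (τ j) (τ (j + 1)), u v ∂ρ := by
          rw [Iic_union_Ioc_eq_Iic (hτ j.le_succ)]
          exact lintegral_mono_set (Iic_subset_Iic.2 hs')
        have h2 : ∫⁻ v in Iic (τ j), u v ∂ρ ≤ C * e * ρ (Iic T) := by
          calc ∫⁻ v in Iic (τ j), u v ∂ρ ≤ ∫⁻ _ in Iic (τ j), C * e ∂ρ :=
                setLIntegral_mono' measurableSet_Iic fun v hv => hC' u e b hb hub h v hv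
            _ = C * e * ρ (Iic (τ j)) := setLIntegral_const _ _
            _ ≤ _ := by
                gcongr
                exact (hτ j.le_succ).trans hτT
        have h3 : ∫⁻ v in Ioc (τ j) (τ (j + 1)), u v ∂ρ ≤ S / 2 := by
          calc ∫⁻ v in Ioc (τ j) (τ (j + 1)), u v ∂ρ
              ≤ ∫⁻ _ in Ioc (τ j) (τ (j + 1)), S ∂ρ :=
                setLIntegral_mono' measurableSet_Ioc fun v hv =>
                  le_iSup₂ (f := fun t (_ : t ∈ Iic (τ (j + 1))) => u t) v hv.2
            _ = S * ρ (Ioc (τ j) (τ (j + 1))) := setLIntegral_const _ _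
            _ ≤ S * ENNReal.ofReal (1 / 2) := by
                gcongr
                exact (ENNReal.le_ofReal_iff_toReal_le (measure_ne_top_of_subset
                  Ioc_subset_Iic_self (hρ _)) (by norm_num)).2 (hτδ j (by omega))
            _ = S / 2 := by
                rw [ENNReal.div_eq_inv_mul, mul_comm, ENNReal.ofReal_div_of_pos (by norm_num)]
                simp
        calc e + ∫⁻ v in Iic s, u v ∂ρ ≤ e + (C * e * ρ (Iic T) + S / 2) := by
              gcongr
              exact h1.trans ((lintegral_union_le _ _ _).trans (add_le_add h2 h3))
          _ = _ := by ring
      have hS2 : S / 2 ≤ e * (1 + C * ρ (Iic T)) := by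
        have : S / 2 + S / 2 ≤ e * (1 + C * ρ (Iic T)) + S / 2 := by
          rwa [ENNReal.add_halves]
        exact (ENNReal.add_le_add_iff_right (by finiteness)).1 this
      calc u t ≤ S := le_iSup₂ (f := fun t (_ : t ∈ Iic (τ (j + 1))) => u t) t ht
        _ = S / 2 + S / 2 := (ENNReal.add_halves S).symm
        _ ≤ e * (1 + C * ρ (Iic T)) + e * (1 + C * ρ (Iic T)) := add_le_add hS2 hS2
        _ = 2 * (1 + C * ρ (Iic T)) * e := by ring
        _ ≤ _ := by
          gcongr
          exact le_add_self
  obtain ⟨C, hC, h⟩ := main m le_rfl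
  exact ⟨C, hC, fun u e b hb hub hu t ht => h u e b hb hub hu t (hτm ▸ ht)⟩

/-! ### The measure with a given rate -/

/-- The measure `r_s ds` on `[0, ∞)`. -/
noncomputable def rateMeasure (r : ℝ≥0 → ℝ) : Measure ℝ≥0 :=
  leb.withDensity fun s => ((r s).toNNReal : ℝ≥0∞)

theorem rateMeasure_absolutelyContinuous (r : ℝ≥0 → ℝ) : rateMeasure r ≪ leb :=
  withDensity_absolutelyContinuous _ _

instance (r : ℝ≥0 → ℝ) : NullSingletonClass (rateMeasure r) where
  measure_singleton x := rateMeasure_absolutelyContinuous r (measure_singleton x)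

theorem LocIntegrable.aemeasurable {r : ℝ≥0 → ℝ} (hr : LocIntegrable r) : AEMeasurable r leb := by
  have h : (⋃ n : ℕ, Iic (n : ℝ≥0)) = univ := by
    refine eq_univ_of_forall fun x => mem_iUnion.2 ?_
    exact exists_nat_ge x
  rw [← Measure.restrict_univ (μ := leb), ← h, aemeasurable_iUnion_iff]
  exact fun n => (hr n).aemeasurable

theorem rateMeasure_apply_eq {r : ℝ≥0 → ℝ} (hr : LocIntegrable r) (hr0 : ∀ t, 0 ≤ r t)
    {S : Set ℝ≥0} (hS : MeasurableSet S) {t : ℝ≥0} (hSt : S ⊆ Iic t) :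
    rateMeasure r S = ENNReal.ofReal (∫ s in S, r s ∂leb) := by
  rw [rateMeasure, withDensity_apply _ hS,
    ofReal_integral_eq_lintegral_ofReal ((hr t).mono_set hSt) (ae_of_all _ hr0)]
  rfl

theorem rateMeasure_Iic_ne_top {r : ℝ≥0 → ℝ} (hr : LocIntegrable r) (hr0 : ∀ t, 0 ≤ r t)
    (t : ℝ≥0) : rateMeasure r (Iic t) ≠ ∞ := by
  rw [rateMeasure_apply_eq hr hr0 measurableSet_Iic subset_rfl]
  exact ENNReal.ofReal_ne_top

theorem setIntegral_rateMeasure {r : ℝ≥0 → ℝ} (hr : LocIntegrable r) (hr0 : ∀ t, 0 ≤ r t)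
    (f : ℝ≥0 → ℝ) {S : Set ℝ≥0} (hS : MeasurableSet S) :
    ∫ s in S, f s ∂(rateMeasure r) = ∫ s in S, r s * f s ∂leb := by
  rw [rateMeasure, setIntegral_withDensity_eq_setIntegral_smul₀ _ _ hS]
  · refine integral_congr_ae (ae_of_all _ fun s => ?_)
    simp [NNReal.smul_def, hr0 s]
  · exact hr.aemeasurable.real_toNNReal.restrict

theorem integrableOn_rateMeasure_iff {r : ℝ≥0 → ℝ} (hr : LocIntegrable r) (hr0 : ∀ t, 0 ≤ r t)
    {f : ℝ≥0 → ℝ} {S : Set ℝ≥0} (hS : MeasurableSet S) :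
    IntegrableOn f S (rateMeasure r) ↔ IntegrableOn (fun s => r s * f s) S leb := by
  rw [IntegrableOn, rateMeasure, restrict_withDensity hS,
    integrable_withDensity_iff_integrable_coe_smul₀ hr.aemeasurable.real_toNNReal.restrict]
  simp [IntegrableOn, hr0]

/-! ### Moments of Poisson processes -/

/-- The Stein-Chen identity. -/
theorem lintegral_mul_poissonMeasure (r : ℝ≥0) (g : ℕ → ℝ≥0∞) :
    ∫⁻ n, n * g n ∂(poissonMeasure r) = r * ∫⁻ n, g (n + 1) ∂(poissonMeasure r) := by
  rw [lintegral_countable', lintegral_countable', tsum_eq_zero_add' ENNReal.summable,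
    ← ENNReal.tsum_mul_left]
  simp only [Nat.cast_zero, zero_mul, zero_add]
  refine tsum_congr fun n => ?_
  rw [poissonMeasure_singleton, poissonMeasure_singleton]
  have h : ((n + 1 : ℕ) : ℝ≥0∞) * ENNReal.ofReal (Real.exp (-r) * r ^ (n + 1) / (n + 1).factorial)
      = r * ENNReal.ofReal (Real.exp (-r) * r ^ n / n.factorial) := by
    rw [← ENNReal.ofReal_natCast, ← ENNReal.ofReal_mul (by positivity),
      ← ENNReal.ofReal_coe_nnreal, ← ENNReal.ofReal_mul (by positivity), Nat.factorial_succ]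
    congr 1
    push_cast
    field_simp
    ring
  calc _ = ((n + 1 : ℕ) : ℝ≥0∞) *
        ENNReal.ofReal (Real.exp (-r) * r ^ (n + 1) / (n + 1).factorial) * g (n + 1) := by ring
    _ = _ := by rw [h]; ring

theorem lintegral_poissonMeasure (r : ℝ≥0) : ∫⁻ n, (n : ℝ≥0∞) ∂(poissonMeasure r) = r := by
  simpa using lintegral_mul_poissonMeasure r 1

theorem lintegral_sq_poissonMeasure (r : ℝ≥0) :
    ∫⁻ n, (n : ℝ≥0∞) * n ∂(poissonMeasure r) = r * (r + 1) := by
  rw [lintegral_mul_poissonMeasure r fun n => n]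
  simp only [Nat.cast_add, Nat.cast_one]
  rw [lintegral_add_right _ measurable_const, lintegral_poissonMeasure]
  simp

theorem CountingPath.measure_Ioc (x : CountingPath) {a b : ℝ≥0} (hab : a ≤ b) :
    x.stieltjes.measure (Ioc a b) = (x b - x a : ℕ) := by
  rw [StieltjesFunction.measure_Ioc, ← ENNReal.ofReal_natCast, Nat.cast_sub (x.mono hab)]
  rfl

theorem CountingPath.measure_Ioc_zero (x : CountingPath) (b : ℝ≥0) :
    x.stieltjes.measure (Ioc 0 b) = x b := by
  rw [x.measure_Ioc zero_le, x.map_zero, Nat.sub_zero]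

/-- The jump measure of a counting path on `(0, T]`. -/
noncomputable def CountingPath.jumps (x : CountingPath) (T : ℝ≥0) : Measure ℝ≥0 :=
  x.stieltjes.measure.restrict (Ioc 0 T)

theorem CountingPath.jumps_Iic (x : CountingPath) (T a : ℝ≥0) :
    x.jumps T (Iic a) = x (min a T) := by
  rw [jumps, Measure.restrict_apply measurableSet_Iic, ← x.measure_Ioc_zero]
  congr 1
  ext s
  simp only [mem_inter_iff, mem_Iic, mem_Ioc, le_min_iff]
  tauto

theorem CountingPath.jumps_univ (x : CountingPath) (T : ℝ≥0) : x.jumps T univ = x T := by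
  rw [jumps, Measure.restrict_apply_univ, x.measure_Ioc_zero]

instance (x : CountingPath) (T : ℝ≥0) : IsFiniteMeasure (x.jumps T) :=
  ⟨by rw [x.jumps_univ]; exact ENNReal.natCast_lt_top _⟩

/-- The σ-algebra `m` is left free so that `pathSigma` can be used for it: this is how independence
of paths passes to their jump measures. -/
theorem measurable_jumps {Ω : Type*} {m : MeasurableSpace Ω} {N : Ω → CountingPath}
    (hN : ∀ t, Measurable fun ω => N ω t) (T : ℝ≥0) : Measurable fun ω => (N ω).jumps T := by
  refine Measurable.measure_of_isPiSystem (S := range Iic)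
    (BorelSpace.measurable_eq.trans (borel_eq_generateFrom_Iic _)) isPiSystem_Iic ?_ ?_
  · rintro _ ⟨a, rfl⟩
    simp only [CountingPath.jumps_Iic]
    exact measurable_from_top.comp (hN _)
  · simp only [CountingPath.jumps_univ]
    exact measurable_from_top.comp (hN _)

section Moments

variable {Ω : Type*} [MeasurableSpace Ω] {P : Measure Ω}
  {N : Ω → CountingPath} {r : ℝ≥0 → ℝ}

/-- The intensity measure on `(0, T]`. -/
noncomputable def intensity (r : ℝ≥0 → ℝ) (T : ℝ≥0) : Measure ℝ≥0 :=
  (rateMeasure r).restrict (Ioc 0 T)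

theorem intensity_Iic (r : ℝ≥0 → ℝ) (T a : ℝ≥0) :
    intensity r T (Iic a) = rateMeasure r (Ioc 0 (min a T)) := by
  rw [intensity, Measure.restrict_apply measurableSet_Iic]
  congr 1
  ext s
  simp only [mem_inter_iff, mem_Iic, mem_Ioc, le_min_iff]
  tauto

theorem isFiniteMeasure_intensity (hr : LocIntegrable r) (hr0 : ∀ t, 0 ≤ r t) (T : ℝ≥0) :
    IsFiniteMeasure (intensity r T) :=
  ⟨by
    rw [intensity, Measure.restrict_apply_univ]
    exact (measure_ne_top_of_subset Ioc_subset_Iic_self (rateMeasure_Iic_ne_top hr hr0 T)).lt_top⟩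

theorem IsPoissonProcess.law_rateMeasure (hN : IsPoissonProcess N r P) (hr : LocIntegrable r)
    (hr0 : ∀ t, 0 ≤ r t) {s t : ℝ≥0} (hst : s ≤ t) :
    HasLaw (fun ω => N ω t - N ω s) (poissonMeasure (rateMeasure r (Ioc s t)).toNNReal) P := by
  rw [rateMeasure_apply_eq hr hr0 measurableSet_Ioc Ioc_subset_Iic_self]
  exact hN.law s t hst

theorem IsPoissonProcess.lintegral_sub (hN : IsPoissonProcess N r P) (hr : LocIntegrable r)
    (hr0 : ∀ t, 0 ≤ r t) {s t : ℝ≥0} (hst : s ≤ t) :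
    ∫⁻ ω, ((N ω t - N ω s : ℕ) : ℝ≥0∞) ∂P = rateMeasure r (Ioc s t) := by
  rw [(hN.law_rateMeasure hr hr0 hst).lintegral_comp (f := fun n => (n : ℝ≥0∞))
    measurable_from_top.aemeasurable, lintegral_poissonMeasure]
  exact ENNReal.coe_toNNReal
    (measure_ne_top_of_subset Ioc_subset_Iic_self (rateMeasure_Iic_ne_top hr hr0 t))

theorem IsPoissonProcess.lintegral_eval (hN : IsPoissonProcess N r P) (hr : LocIntegrable r)
    (hr0 : ∀ t, 0 ≤ r t) (t : ℝ≥0) :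
    ∫⁻ ω, (N ω t : ℝ≥0∞) ∂P = rateMeasure r (Ioc 0 t) := by
  rw [← hN.lintegral_sub hr hr0 (zero_le (a := t))]
  simp [CountingPath.map_zero]

/-- Splitting N_b into N_a and an independent increment leaves the second moment of a Poisson
variable, known from the Stein-Chen identity, and a product of means. -/
theorem IsPoissonProcess.lintegral_eval_mul_eval (hN : IsPoissonProcess N r P)
    (hr : LocIntegrable r) (hr0 : ∀ t, 0 ≤ r t) {a b : ℝ≥0} (hab : a ≤ b) :
    ∫⁻ ω, (N ω a : ℝ≥0∞) * N ω b ∂P =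
      rateMeasure r (Ioc 0 a) * rateMeasure r (Ioc 0 b) + rateMeasure r (Ioc 0 a) := by
  have hne : rateMeasure r (Ioc 0 a) ≠ ∞ :=
    measure_ne_top_of_subset Ioc_subset_Iic_self (rateMeasure_Iic_ne_top hr hr0 a)
  have hsq : ∫⁻ ω, (N ω a : ℝ≥0∞) * N ω a ∂P =
      rateMeasure r (Ioc 0 a) * (rateMeasure r (Ioc 0 a) + 1) := by
    have h := (hN.law_rateMeasure hr hr0 (zero_le (a := a))).lintegral_comp
      (f := fun n : ℕ => (n : ℝ≥0∞) * n) measurable_from_top.aemeasurable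
    rw [lintegral_sq_poissonMeasure, ENNReal.coe_toNNReal hne] at h
    simpa [CountingPath.map_zero] using h
  have hind : ∫⁻ ω, (N ω a : ℝ≥0∞) * ((N ω b - N ω a : ℕ) : ℝ≥0∞) ∂P =
      rateMeasure r (Ioc 0 a) * rateMeasure r (Ioc a b) := by
    have h := (hN.indep_increments.indepFun_sub_sub (zero_le (a := a)) hab).comp
      (φ := fun n : ℕ => (n : ℝ≥0∞)) (ψ := fun n : ℕ => (n : ℝ≥0∞))
      measurable_from_top measurable_from_top
    have h2 := lintegral_mul_eq_lintegral_mul_lintegral_of_indepFun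
      (measurable_from_top.comp ((hN.measurable a).sub (hN.measurable 0)))
      (measurable_from_top.comp ((hN.measurable b).sub (hN.measurable a))) h
    simp only [Pi.mul_apply, Function.comp_apply, Pi.sub_apply, CountingPath.map_zero,
      Nat.sub_zero] at h2
    rw [h2, hN.lintegral_eval hr hr0, hN.lintegral_sub hr hr0 hab]
  have hsplit : rateMeasure r (Ioc 0 b) = rateMeasure r (Ioc 0 a) + rateMeasure r (Ioc a b) := by
    rw [← measure_union (Ioc_disjoint_Ioc_of_le le_rfl) measurableSet_Ioc,
      Ioc_union_Ioc_eq_Ioc zero_le hab]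
  have hmeas : Measurable fun ω => (N ω a : ℝ≥0∞) := measurable_from_top.comp (hN.measurable a)
  calc ∫⁻ ω, (N ω a : ℝ≥0∞) * N ω b ∂P
      = ∫⁻ ω, (N ω a : ℝ≥0∞) * N ω a + (N ω a : ℝ≥0∞) * ((N ω b - N ω a : ℕ) : ℝ≥0∞) ∂P := by
        refine lintegral_congr fun ω => ?_
        rw [← mul_add, ← Nat.cast_add, Nat.add_sub_cancel' ((N ω).mono hab)]
    _ = _ := by
        rw [lintegral_add_left (by fun_prop), hsq, hind, hsplit]
        ring

/-- Campbell's formula: the intensity measure is the mean of the jump measure. -/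
theorem IsPoissonProcess.lintegral_jumps (hN : IsPoissonProcess N r P) (hr : LocIntegrable r)
    (hr0 : ∀ t, 0 ≤ r t) (T : ℝ≥0) {E : Set ℝ≥0} (hE : MeasurableSet E) :
    ∫⁻ ω, (N ω).jumps T E ∂P = intensity r T E := by
  have hm := (measurable_jumps hN.measurable T).aemeasurable (μ := P)
  have := isFiniteMeasure_intensity hr hr0 T
  -- The averaged jump measure is itself a measure, so it is determined by its values on half-lines.
  rw [← Measure.bind_apply hE hm]
  congr 1
  refine (Measure.ext_of_Iic _ _ fun a => ?_).symm
  rw [Measure.bind_apply measurableSet_Iic hm, intensity_Iic, ← hN.lintegral_eval hr hr0]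
  simp only [CountingPath.jumps_Iic]

/-- With one set fixed, both sides are measures in the other set, so the formula extends from
half-lines to Borel sets one variable at a time. -/
theorem IsPoissonProcess.lintegral_jumps_mul_jumps (hN : IsPoissonProcess N r P)
    (hr : LocIntegrable r) (hr0 : ∀ t, 0 ≤ r t) (T : ℝ≥0) {E F : Set ℝ≥0} (hE : MeasurableSet E)
    (hF : MeasurableSet F) :
    ∫⁻ ω, (N ω).jumps T E * (N ω).jumps T F ∂P =
      intensity r T E * intensity r T F + intensity r T (E ∩ F) := by
  have hm := measurable_jumps hN.measurable T
  have hmE : ∀ {G : Set ℝ≥0}, MeasurableSet G → Measurable fun ω => (N ω).jumps T G :=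
    fun hG => (Measure.measurable_coe hG).comp hm
  have hfin := isFiniteMeasure_intensity hr hr0 T
  -- Weighting P by the number of jumps in G exhibits the mixed moment as a measure in H.
  have hbind : ∀ {G H : Set ℝ≥0}, MeasurableSet G → MeasurableSet H →
      (P.withDensity fun ω => (N ω).jumps T G).bind (fun ω => (N ω).jumps T) H =
        ∫⁻ ω, (N ω).jumps T G * (N ω).jumps T H ∂P := by
    intro G H hG hH
    rw [Measure.bind_apply hH hm.aemeasurable,
      lintegral_withDensity_eq_lintegral_mul _ (hmE hG) (hmE hH)]
    rfl
  have hrhs : ∀ {G H : Set ℝ≥0}, MeasurableSet H →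
      (intensity r T G • intensity r T + (intensity r T).restrict G) H =
        intensity r T G * intensity r T H + intensity r T (G ∩ H) := by
    intro G H hH
    simp [Measure.restrict_apply hH, inter_comm]
  have ext_step : ∀ {G : Set ℝ≥0}, MeasurableSet G →
      (∀ b, ∫⁻ ω, (N ω).jumps T G * (N ω).jumps T (Iic b) ∂P =
        intensity r T G * intensity r T (Iic b) + intensity r T (G ∩ Iic b)) →
      ∀ {H : Set ℝ≥0}, MeasurableSet H → ∫⁻ ω, (N ω).jumps T G * (N ω).jumps T H ∂P =
        intensity r T G * intensity r T H + intensity r T (G ∩ H) := by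
    intro G hG h H hH
    have hf : IsFiniteMeasure (intensity r T G • intensity r T + (intensity r T).restrict G) := by
      have := Measure.smul_finite (intensity r T) (measure_ne_top (intensity r T) G)
      infer_instance
    rw [← hbind hG hH, ← hrhs hH]
    congr 1
    refine (Measure.ext_of_Iic _ _ fun b => ?_).symm
    rw [hbind hG measurableSet_Iic, hrhs measurableSet_Iic, h b]
  have hIic : ∀ a b, ∫⁻ ω, (N ω).jumps T (Iic a) * (N ω).jumps T (Iic b) ∂P =
      intensity r T (Iic a) * intensity r T (Iic b) + intensity r T (Iic a ∩ Iic b) := by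
    intro a b
    wlog hab : a ≤ b generalizing a b
    · rw [inter_comm, mul_comm, ← this b a (le_of_not_ge hab)]
      simp only [mul_comm]
    rw [inter_eq_left.2 (Iic_subset_Iic.2 hab)]
    simp only [CountingPath.jumps_Iic, intensity_Iic]
    exact hN.lintegral_eval_mul_eval hr hr0 (min_le_min_right T hab)
  -- Two extensions, with the symmetry of the formula used in between.
  refine ext_step hE (fun b => ?_) hF
  have := ext_step (measurableSet_Iic (a := b)) (fun a => hIic b a) hE
  rw [inter_comm, mul_comm, ← this]
  simp only [mul_comm]

theorem IsPoissonProcess.memLp_jumps (hN : IsPoissonProcess N r P) (hr : LocIntegrable r)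
    (hr0 : ∀ t, 0 ≤ r t) (T : ℝ≥0) {E : Set ℝ≥0} (hE : MeasurableSet E) :
    MemLp (fun ω => ((N ω).jumps T E).toReal) 2 P := by
  have hm : Measurable fun ω => (N ω).jumps T E :=
    (Measure.measurable_coe hE).comp (measurable_jumps hN.measurable T)
  have hfin := isFiniteMeasure_intensity hr hr0 T
  refine ⟨hm.ennreal_toReal.aestronglyMeasurable, ?_⟩
  rw [eLpNorm_lt_top_iff_lintegral_rpow_enorm_lt_top (by simp) (by simp)]
  have : ∀ ω, ‖((N ω).jumps T E).toReal‖ₑ ^ (2 : ℝ≥0∞).toReal =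
      (N ω).jumps T E * (N ω).jumps T E := by
    intro ω
    rw [Real.enorm_of_nonneg ENNReal.toReal_nonneg, ENNReal.ofReal_toReal (measure_ne_top _ _)]
    simp [sq]
  simp only [this]
  rw [hN.lintegral_jumps_mul_jumps hr hr0 T hE hE]
  finiteness

theorem IsPoissonProcess.integral_jumps (hN : IsPoissonProcess N r P) (hr : LocIntegrable r)
    (hr0 : ∀ t, 0 ≤ r t) (T : ℝ≥0) {E : Set ℝ≥0} (hE : MeasurableSet E) :
    ∫ ω, ((N ω).jumps T E).toReal ∂P = (intensity r T E).toReal := by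
  have hm : Measurable fun ω => (N ω).jumps T E :=
    (Measure.measurable_coe hE).comp (measurable_jumps hN.measurable T)
  rw [integral_toReal hm.aemeasurable (ae_of_all _ fun ω => measure_lt_top _ _),
    hN.lintegral_jumps hr hr0 T hE]

/-- The product term of the mixed moment cancels the squared mean and leaves the mass of E ∩ E. -/
theorem IsPoissonProcess.variance_jumps [IsProbabilityMeasure P]
    (hN : IsPoissonProcess N r P) (hr : LocIntegrable r)
    (hr0 : ∀ t, 0 ≤ r t) (T : ℝ≥0) {E : Set ℝ≥0} (hE : MeasurableSet E) :
    Var[fun ω => ((N ω).jumps T E).toReal; P] = (intensity r T E).toReal := by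
  have hm : Measurable fun ω => (N ω).jumps T E :=
    (Measure.measurable_coe hE).comp (measurable_jumps hN.measurable T)
  have hfin := isFiniteMeasure_intensity hr hr0 T
  rw [variance_eq_sub (hN.memLp_jumps hr hr0 T hE), hN.integral_jumps hr hr0 T hE]
  have : ∫ ω, ((fun ω => ((N ω).jumps T E).toReal) ^ 2) ω ∂P =
      ∫ ω, ((N ω).jumps T E * (N ω).jumps T E).toReal ∂P := by
    refine integral_congr_ae (ae_of_all _ fun ω => ?_)
    simp [sq]
  rw [this, integral_toReal (by fun_prop) (ae_of_all _ fun ω => by finiteness),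
    hN.lintegral_jumps_mul_jumps hr hr0 T hE hE, inter_self,
    ENNReal.toReal_add (by finiteness) (by finiteness), ENNReal.toReal_mul]
  ring

end Moments

/-! ### Laws of large numbers -/

section WithHighProbability

variable {Ω : Type*} [MeasurableSpace Ω]

/-- The filter of the events, indexed by `n`, whose probability tends to `1` as `n → ∞`
(in the sense that the outer probability of the complement tends to `0`). -/
def whp (P : Measure Ω) : Filter (ℕ × Ω) where
  sets := {S | Tendsto (fun n => P {ω | (n, ω) ∉ S}) atTop (𝓝 0)}
  univ_sets := by simp
  sets_of_superset {S S'} hS h :=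
    tendsto_of_tendsto_of_tendsto_of_le_of_le tendsto_const_nhds hS (fun _ => zero_le)
      fun n => measure_mono fun ω hω hω' => hω (h hω')
  inter_sets {S S'} hS hS' := by
    have h := Tendsto.add (show Tendsto _ _ _ from hS) (show Tendsto _ _ _ from hS')
    rw [add_zero] at h
    refine tendsto_of_tendsto_of_tendsto_of_le_of_le tendsto_const_nhds h (fun _ => zero_le)
      fun n => ?_
    refine le_trans (measure_mono fun ω hω => ?_) (measure_union_le _ _)
    simp only [mem_ofPred_eq, mem_inter_iff, not_and_or] at hω
    exact hω

variable {P : Measure Ω}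

theorem eventually_whp_iff {p : ℕ × Ω → Prop} :
    (∀ᶠ z in whp P, p z) ↔ Tendsto (fun n => P {ω | ¬ p (n, ω)}) atTop (𝓝 0) :=
  Iff.rfl

theorem eventually_whp_of_ae {p : ℕ × Ω → Prop} (h : ∀ᶠ n in atTop, ∀ᵐ ω ∂P, p (n, ω)) :
    ∀ᶠ z in whp P, p z := by
  rw [eventually_whp_iff]
  refine tendsto_const_nhds.congr' ?_
  filter_upwards [h] with n hn
  exact (ae_iff.1 hn).symm

theorem eventually_whp_pos : ∀ᶠ z in whp P, 0 < z.1 :=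
  eventually_whp_of_ae (p := fun z => 0 < z.1)
    ((eventually_gt_atTop 0).mono fun _ hn => ae_of_all _ fun _ => hn)

/-- Nontriviality turns an event of high probability into an actual pair (n, ω); the solution of the
fluid equation is built from such pairs. -/
instance [IsProbabilityMeasure P] : (whp P).NeBot := by
  refine ⟨fun h => ?_⟩
  have h1 : ∀ᶠ _ in whp P, False := by rw [h]; exact eventually_bot
  rw [eventually_whp_iff] at h1
  simp at h1

/-- Chebyshev's inequality, with ε / 2 spent on the distance of the mean from `l` and ε / 2 on the
fluctuation. -/
theorem eventually_whp_of_variance [IsFiniteMeasure P] {X : ℕ → Ω → ℝ} {l : ℝ}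
    (hX : ∀ᶠ n in atTop, MemLp (X n) 2 P) (hmean : Tendsto (fun n => ∫ ω, X n ω ∂P) atTop (𝓝 l))
    (hvar : Tendsto (fun n => Var[X n; P]) atTop (𝓝 0)) {ε : ℝ} (hε : 0 < ε) :
    ∀ᶠ z in whp P, |X z.1 z.2 - l| < ε := by
  rw [eventually_whp_iff]
  have h0 : Tendsto (fun n => ENNReal.ofReal (Var[X n; P] / (ε / 2) ^ 2)) atTop (𝓝 0) := by
    have := ENNReal.tendsto_ofReal (hvar.div_const ((ε / 2) ^ 2))
    simpa using this
  refine tendsto_of_tendsto_of_tendsto_of_le_of_le' tendsto_const_nhds h0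
    (Eventually.of_forall fun _ => zero_le) ?_
  filter_upwards [hX, hmean.eventually (Metric.ball_mem_nhds l (half_pos hε))] with n hn hm
  refine (measure_mono fun ω hω => ?_).trans (meas_ge_le_variance_div_sq hn (half_pos hε))
  simp only [mem_ofPred_eq, not_lt] at hω ⊢
  rw [Real.dist_eq] at hm
  have := abs_sub_le (X n ω) (∫ ω, X n ω ∂P) l
  linarith

end WithHighProbability

/-- `∑_{i ≥ 1} ∫_S 1(h_s ≥ i) dx^i_s`. -/
noncomputable def thinned (x : ℕ → CountingPath) (h : ℝ≥0 → ℝ) (S : Set ℝ≥0) : ℝ≥0∞ :=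
  ∑' i : ℕ, (x i).stieltjes.measure (S ∩ {s | (i : ℝ) + 1 ≤ h s})

theorem thinned_mono (x : ℕ → CountingPath) {h h' : ℝ≥0 → ℝ} {S : Set ℝ≥0}
    (hh : ∀ s ∈ S, h s ≤ h' s) : thinned x h S ≤ thinned x h' S :=
  ENNReal.tsum_le_tsum fun _ => measure_mono fun s hs => ⟨hs.1, hs.2.trans (hh s hs.1)⟩

theorem thinned_union (x : ℕ → CountingPath) (h : ℝ≥0 → ℝ) {a b c : ℝ≥0} (hab : a ≤ b)
    (hbc : b ≤ c) :
    thinned x h (Ioc a c) = thinned x h (Ioc a b) + thinned x h (Ioc b c) := by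
  rw [thinned, thinned, thinned, ← ENNReal.tsum_add]
  refine tsum_congr fun i => ?_
  rw [← measure_inter_add_sdiff _ (measurableSet_Ioc (a := a) (b := b))]
  congr 2
  · ext s
    simp only [mem_inter_iff, mem_Ioc]
    exact ⟨fun hs => ⟨hs.2, hs.1.2⟩, fun hs => ⟨⟨⟨hs.1.1, hs.1.2.trans hbc⟩, hs.2⟩, hs.1⟩⟩
  · ext s
    simp only [mem_inter_iff, Set.mem_sdiff, mem_Ioc, not_and, not_le]
    exact ⟨fun hs => ⟨⟨hs.2 hs.1.1.1, hs.1.1.2⟩, hs.1.2⟩,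
      fun hs => ⟨⟨⟨hab.trans_lt hs.1.1, hs.1.2⟩, hs.2⟩, fun _ => hs.1.1⟩⟩

/-- Clock `i` starts to run at level i + 1, so a level of at most `c` involves only the indices
below ⌊c⌋. -/
theorem thinned_eq_sum (x : ℕ → CountingPath) {h : ℝ≥0 → ℝ} {S : Set ℝ≥0} {c : ℝ}
    (hh : ∀ s ∈ S, h s ≤ c) : thinned x h S =
      ∑ i ∈ Finset.range ⌊c⌋₊, (x i).stieltjes.measure (S ∩ {s | (i : ℝ) + 1 ≤ h s}) := by
  refine tsum_eq_sum fun i hi => ?_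
  have : S ∩ {s | (i : ℝ) + 1 ≤ h s} = ∅ := by
    refine eq_empty_of_forall_notMem fun s hs => hi ?_
    rw [Finset.mem_range, ← Nat.succ_le_iff, Nat.succ_eq_add_one, Nat.le_floor_iff' (by simp)]
    push_cast
    exact le_trans hs.2 (hh s hs.1)
  rw [this, measure_empty]

theorem thinned_ne_top (x : ℕ → CountingPath) {h : ℝ≥0 → ℝ} {a b : ℝ≥0} {c : ℝ}
    (hh : ∀ s ∈ Ioc a b, h s ≤ c) : thinned x h (Ioc a b) ≠ ∞ := by
  rw [thinned_eq_sum x hh]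
  refine (ENNReal.sum_lt_top.2 fun i _ => ?_).ne
  refine (measure_mono inter_subset_left).trans_lt ?_
  rw [StieltjesFunction.measure_Ioc]
  exact ENNReal.ofReal_lt_top

section Laws

variable {Ω : Type*} [MeasurableSpace Ω] {P : Measure Ω}

/-- By Campbell's formula the expected number of jumps in a Lebesgue null set is zero. This permits
replacing a Lebesgue measurable level by a Borel version along almost every path. -/
theorem IsPoissonProcess.ae_jumps {N : Ω → CountingPath} {r : ℝ≥0 → ℝ}
    (hN : IsPoissonProcess N r P) (hr : LocIntegrable r) (hr0 : ∀ t, 0 ≤ r t) (T : ℝ≥0)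
    {p : ℝ≥0 → Prop} (hp : ∀ᵐ s ∂leb, p s) : ∀ᵐ ω ∂P, ∀ᵐ s ∂(N ω).jumps T, p s := by
  set Z := toMeasurable leb {s | ¬ p s} with hZ
  have hZm : MeasurableSet Z := measurableSet_toMeasurable _ _
  have hZ0 : intensity r T Z = 0 := by
    refine le_antisymm ((Measure.restrict_apply_le _ _).trans_eq ?_) zero_le
    exact rateMeasure_absolutelyContinuous r ((measure_toMeasurable _).trans (ae_iff.1 hp))
  have hm : Measurable fun ω => (N ω).jumps T Z :=
    (Measure.measurable_coe hZm).comp (measurable_jumps hN.measurable T)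
  have h := hN.lintegral_jumps hr hr0 T hZm
  rw [hZ0, lintegral_eq_zero_iff hm] at h
  filter_upwards [h] with ω hω
  exact measure_mono_null (subset_toMeasurable _ _) hω

/-- The level is deterministic, so the count is a sum of at most n |M| pairwise independent terms,
each with variance equal to its mean. After division by n the variance is O(1 / n), and the mean is
the integral of ⌊h n⌋₊ / n, which converges by dominated convergence. -/
theorem thinned_law_of_large_numbers [IsProbabilityMeasure P] {N : ℕ → ℕ → Ω → CountingPath}
    {r : ℝ≥0 → ℝ} (hr : LocIntegrable r) (hr0 : ∀ t, 0 ≤ r t)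
    (hN : ∀ n, 0 < n → ∀ i, IsPoissonProcess (N n i) r P)
    (hind : ∀ n, 0 < n → ∀ i j, i ≠ j → Indep (pathSigma (N n i)) (pathSigma (N n j)) P)
    {h : ℕ → ℝ≥0 → ℝ} (hmeas : ∀ n, 0 < n → AEMeasurable (h n) leb) {g : ℝ≥0 → ℝ} {a b : ℝ≥0}
    (hlim : ∀ᵐ s ∂leb, s ∈ Ioc a b → Tendsto (fun n : ℕ => h n s / n) atTop (𝓝 (g s)))
    {M : ℝ} (hM : ∀ n, 0 < n → ∀ s ∈ Ioc a b, h n s ≤ n * M) {ε : ℝ} (hε : 0 < ε) :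
    ∀ᶠ z in whp P, |(thinned (fun i => N z.1 i z.2) (h z.1) (Ioc a b)).toReal / z.1 -
      ∫ s in Ioc a b, max (g s) 0 ∂(rateMeasure r)| < ε := by
  have hI : Ioc a b ⊆ Ioc 0 b := Ioc_subset_Ioc_left zero_le
  have hborel : ∀ n, ∃ f : ℝ≥0 → ℝ, Measurable f ∧ (0 < n → h n =ᵐ[leb] f) := fun n => by
    by_cases hn : 0 < n
    · exact ⟨(hmeas n hn).mk, (hmeas n hn).measurable_mk, fun _ => (hmeas n hn).ae_eq_mk⟩
    · exact ⟨0, measurable_const, fun h => absurd h hn⟩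
  choose f hf hhf using hborel
  set F : ℕ → ℕ → Set ℝ≥0 := fun n i => {s | (i : ℝ) + 1 ≤ f n s} with hF
  have hFm : ∀ n i, MeasurableSet (F n i) := fun n i => measurableSet_le measurable_const (hf n)
  have hE : ∀ n i, MeasurableSet (Ioc a b ∩ F n i) := fun n i => measurableSet_Ioc.inter (hFm n i)
  set m : ℕ → ℕ := fun n => ⌊n * M⌋₊ with hm
  -- The absolute value is needed because M may be negative: the lowest grid level used later is -δ.
  have hmM : ∀ n : ℕ, (m n : ℝ) / n ≤ |M| := fun n => by
    rcases Nat.eq_zero_or_pos n with rfl | hn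
    · simp
    · rw [div_le_iff₀ (by exact_mod_cast hn)]
      rcases le_or_gt 0 (n * M) with h0 | h0
      · calc (m n : ℝ) ≤ n * M := Nat.floor_le h0
          _ ≤ |M| * n := by rw [mul_comm]; gcongr; exact le_abs_self M
      · rw [show m n = 0 from Nat.floor_of_nonpos h0.le, Nat.cast_zero]
        positivity
  set Y : ℕ → ℕ → Ω → ℝ := fun n i ω => ((N n i ω).jumps b (Ioc a b ∩ F n i)).toReal with hY
  set X : ℕ → Ω → ℝ := fun n ω => (∑ i ∈ Finset.range (m n), Y n i ω) / n with hX
  set ν : Measure ℝ≥0 := (rateMeasure r).restrict (Ioc a b) with hν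
  have hνfin : IsFiniteMeasure ν := ⟨by
    rw [hν, Measure.restrict_apply_univ]
    exact (measure_ne_top_of_subset Ioc_subset_Iic_self (rateMeasure_Iic_ne_top hr hr0 b)).lt_top⟩
  have hint : ∀ n i, intensity r b (Ioc a b ∩ F n i) = ν (F n i) := fun n i => by
    rw [intensity, hν, Measure.restrict_apply (hFm n i), Measure.restrict_apply (hE n i)]
    congr 1
    ext s
    simp only [mem_inter_iff]
    exact ⟨fun hs => ⟨hs.1.2, hs.1.1⟩, fun hs => ⟨⟨hs.2, hs.1⟩, hI hs.2⟩⟩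
  have hYp : ∀ n, 0 < n → ∀ i, MemLp (Y n i) 2 P := fun n hn i =>
    (hN n hn i).memLp_jumps hr hr0 b (hE n i)
  have hmemLp : ∀ n, 0 < n → MemLp (X n) 2 P := fun n hn => by
    have := (memLp_finsetSum (Finset.range (m n)) fun i _ => hYp n hn i).const_mul ((n : ℝ)⁻¹)
    refine this.congr_norm (this.1.congr ?_) ?_ <;> refine ae_of_all _ fun ω => ?_ <;>
      simp [hX, div_eq_inv_mul]
  have hmean : ∀ n, 0 < n → ∫ ω, X n ω ∂P =
      ∫ s, (∑ i ∈ Finset.range (m n), (F n i).indicator (1 : ℝ≥0 → ℝ) s) / n ∂ν := by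
    intro n hn
    rw [hX]
    simp only
    rw [integral_div, integral_div, integral_finsetSum, integral_finsetSum]
    · congr 1
      refine Finset.sum_congr rfl fun i _ => ?_
      rw [integral_indicator_one (hFm n i), hY]
      simp only
      rw [(hN n hn i).integral_jumps hr hr0 b (hE n i), hint]
      rfl
    · exact fun i _ => (integrable_const (1 : ℝ)).indicator (hFm n i)
    · exact fun i _ => (hYp n hn i).integrable one_le_two
  have hvar : ∀ n, 0 < n → Var[X n; P] ≤ |M| * ν.real univ / n := by
    intro n hn
    have hn' : (0 : ℝ) < n := by exact_mod_cast hn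
    have h1 : X n = fun ω => (n : ℝ)⁻¹ * (∑ i ∈ Finset.range (m n), Y n i) ω := by
      ext ω
      simp [hX, div_eq_inv_mul]
    -- Measurability with respect to the σ-algebra of the path itself is what lets the counts
    -- inherit independence.
    have hYm : ∀ i, Measurable[pathSigma (N n i)] (Y n i) := fun i => by
      have hNm : ∀ t, Measurable[pathSigma (N n i)] fun ω => N n i ω t := fun t =>
        Measurable.mono (Measurable.of_comap_le le_rfl)
          (le_iSup (fun t => MeasurableSpace.comap (fun ω => N n i ω t) ⊤) t) le_rfl
      exact ((Measure.measurable_coe (hE n i)).comp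
        (measurable_jumps (m := pathSigma (N n i)) hNm b)).ennreal_toReal
    have hindY : ∀ i j, i ≠ j → Y n i ⟂ᵢ[P] Y n j := fun i j hij => by
      rw [IndepFun_iff_Indep]
      exact indep_of_indep_of_le_left (indep_of_indep_of_le_right (hind n hn i j hij)
        (hYm j).comap_le) (hYm i).comap_le
    rw [h1, variance_const_mul, IndepFun.variance_sum (fun i _ => hYp n hn i)
      fun i _ j _ hij => hindY i j hij]
    calc ((n : ℝ)⁻¹) ^ 2 * ∑ i ∈ Finset.range (m n), Var[Y n i; P]
        ≤ ((n : ℝ)⁻¹) ^ 2 * ∑ i ∈ Finset.range (m n), ν.real univ := by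
          gcongr with i
          rw [hY]
          simp only
          rw [(hN n hn i).variance_jumps hr hr0 b (hE n i), hint]
          exact measureReal_mono (subset_univ _)
      _ = (m n / n) * ν.real univ / n := by
          rw [Finset.sum_const, Finset.card_range, nsmul_eq_mul]
          field_simp
      _ ≤ _ := by
          gcongr
          exact hmM n
  have hae : ∀ n, 0 < n → ∀ᵐ ω ∂P,
      (thinned (fun i => N n i ω) (h n) (Ioc a b)).toReal / n = X n ω := by
    intro n hn
    have hall : ∀ᵐ ω ∂P, ∀ i, ∀ᵐ s ∂(N n i ω).jumps b, h n s = f n s :=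
      ae_all_iff.2 fun i => (hN n hn i).ae_jumps hr hr0 b (hhf n hn)
    filter_upwards [hall] with ω hω
    rw [thinned_eq_sum _ (hM n hn), ENNReal.toReal_sum]
    · rw [hX]
      simp only
      congr 1
      refine Finset.sum_congr rfl fun i _ => ?_
      rw [hY]
      simp only
      rw [show (N n i ω).stieltjes.measure (Ioc a b ∩ {s | (i : ℝ) + 1 ≤ h n s}) =
        (N n i ω).jumps b (Ioc a b ∩ {s | (i : ℝ) + 1 ≤ h n s}) from
        (Measure.restrict_eq_self _ (inter_subset_left.trans hI)).symm]
      congr 1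
      refine measure_congr ?_
      filter_upwards [hω i] with s hs
      refine propext ?_
      change (s ∈ Ioc a b ∧ (i : ℝ) + 1 ≤ h n s) ↔ (s ∈ Ioc a b ∧ (i : ℝ) + 1 ≤ f n s)
      rw [hs]
    · intro i _
      refine ((measure_mono inter_subset_left).trans_lt ?_).ne
      rw [StieltjesFunction.measure_Ioc]
      exact ENNReal.ofReal_lt_top
  have hmeanlim : Tendsto (fun n => ∫ ω, X n ω ∂P) atTop (𝓝 (∫ s, max (g s) 0 ∂ν)) := by
    have hdct : Tendsto (fun n : ℕ =>
        ∫ s, (∑ i ∈ Finset.range (m n), (F n i).indicator (1 : ℝ≥0 → ℝ) s) / n ∂ν) atTop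
        (𝓝 (∫ s, max (g s) 0 ∂ν)) := by
      refine tendsto_integral_of_dominated_convergence (fun _ => |M|) (fun n => ?_)
        (integrable_const _) (fun n => ae_of_all _ fun s => ?_) ?_
      · refine Measurable.aestronglyMeasurable ?_
        refine Measurable.div_const ?_ _
        exact Finset.measurable_fun_sum _ fun i _ => measurable_one.indicator (hFm n i)
      · rw [Real.norm_of_nonneg (by
          refine div_nonneg (Finset.sum_nonneg fun i _ => ?_) (by positivity)
          exact indicator_nonneg (fun _ _ => zero_le_one) _)]
        refine le_trans ?_ (hmM n)
        gcongr
        calc ∑ i ∈ Finset.range (m n), (F n i).indicator (1 : ℝ≥0 → ℝ) s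
            ≤ ∑ i ∈ Finset.range (m n), (1 : ℝ) :=
              Finset.sum_le_sum fun i _ => indicator_le_self' (fun _ _ => zero_le_one) s
          _ = m n := by simp
      · have hfall : ∀ᵐ s ∂leb, ∀ n, 0 < n → h n s = f n s :=
          ae_all_iff.2 fun n => by
            by_cases hn : 0 < n
            · filter_upwards [hhf n hn] with s hs _ using hs
            · exact ae_of_all _ fun s h => absurd h hn
        have hac : ν ≪ leb :=
          Measure.restrict_le_self.absolutelyContinuous.trans (rateMeasure_absolutelyContinuous r)
        filter_upwards [hac.ae_le hfall, hac.ae_le hlim, ae_restrict_mem measurableSet_Ioc] with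
          s hs1 hs2 hs
        -- Exactly ⌊h n s⌋₊ clocks are active at s, none at a negative level; hence the positive
        -- part in the limit. Rounding costs at most 1 / n after rescaling.
        have hcount : ∀ n : ℕ, 0 < n →
            ∑ i ∈ Finset.range (m n), (F n i).indicator (1 : ℝ≥0 → ℝ) s = ⌊h n s⌋₊ := by
          intro n hn
          have hle : ⌊h n s⌋₊ ≤ m n := Nat.floor_le_floor (hM n hn s hs)
          have : ∀ i, (F n i).indicator (1 : ℝ≥0 → ℝ) s = if i < ⌊h n s⌋₊ then 1 else 0 := by
            intro i
            rw [indicator_apply]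
            refine if_congr ?_ rfl rfl
            rw [← Nat.succ_le_iff, Nat.succ_eq_add_one, Nat.le_floor_iff' (by simp), hs1 n hn]
            push_cast
            rfl
          simp only [this]
          rw [Finset.sum_ite, Finset.sum_const_zero, add_zero, Finset.sum_const, nsmul_one]
          congr 1
          rw [show (Finset.range (m n)).filter (· < ⌊h n s⌋₊) = Finset.range ⌊h n s⌋₊ by
            ext i; simp only [Finset.mem_filter, Finset.mem_range]; omega]
          simp
        have hup : Tendsto (fun n : ℕ => max (h n s / n) 0) atTop (𝓝 (max (g s) 0)) :=
          (hs2 hs).max tendsto_const_nhds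
        have hlo : Tendsto (fun n : ℕ => max (h n s / n) 0 - 1 / n) atTop (𝓝 (max (g s) 0)) := by
          simpa using hup.sub (tendsto_one_div_atTop_nhds_zero_nat (𝕜 := ℝ))
        refine tendsto_of_tendsto_of_tendsto_of_le_of_le' hlo hup ?_ ?_ <;>
          filter_upwards [eventually_gt_atTop 0] with n hn <;> rw [hcount n hn] <;>
          have hn' : (0 : ℝ) < n := by exact_mod_cast hn
        · rw [sub_le_iff_le_add, ← add_div]
          refine max_le ?_ (by positivity)
          gcongr
          exact (Nat.lt_floor_add_one _).le
        · rcases le_or_gt 0 (h n s) with h0 | h0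
          · refine le_max_of_le_left ?_
            gcongr
            exact Nat.floor_le h0
          · simp [Nat.floor_of_nonpos h0.le]
    refine hdct.congr' ?_
    filter_upwards [eventually_gt_atTop 0] with n hn
    exact (hmean n hn).symm
  have hvarlim : Tendsto (fun n => Var[X n; P]) atTop (𝓝 0) := by
    refine tendsto_of_tendsto_of_tendsto_of_le_of_le' tendsto_const_nhds
      (tendsto_const_div_atTop_nhds_zero_nat (|M| * ν.real univ))
      (Eventually.of_forall fun n => variance_nonneg _ _) ?_
    filter_upwards [eventually_gt_atTop 0] with n hn using hvar n hn
  have hXev := eventually_whp_of_variance (P := P)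
    ((eventually_gt_atTop 0).mono fun n hn => hmemLp n hn) hmeanlim hvarlim hε
  have haew := eventually_whp_of_ae (P := P) (p := fun z =>
    (thinned (fun i => N z.1 i z.2) (h z.1) (Ioc a b)).toReal / z.1 = X z.1 z.2)
    ((eventually_gt_atTop 0).mono hae)
  filter_upwards [hXev, haew] with z h1 h2
  rw [h2]
  exact h1

/-- A single process whose rate grows with n: the variance of A_t / n is its mean divided by n. -/
theorem counting_law_of_large_numbers [IsProbabilityMeasure P] {A : ℕ → Ω → CountingPath}
    {lamn : ℕ → ℝ≥0 → ℝ} (hr : ∀ n, 0 < n → LocIntegrable (lamn n))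
    (hr0 : ∀ n, 0 < n → ∀ t, 0 ≤ lamn n t)
    (hA : ∀ n, 0 < n → IsPoissonProcess (A n) (lamn n) P) {t : ℝ≥0} {l : ℝ}
    (hlim : Tendsto (fun n : ℕ => ∫ s in Iic t, lamn n s / n ∂leb) atTop (𝓝 l)) {ε : ℝ}
    (hε : 0 < ε) : ∀ᶠ z in whp P, |(A z.1 z.2 t : ℝ) / z.1 - l| < ε := by
  have hX : ∀ (n : ℕ) ω, (A n ω t : ℝ) / n = (n : ℝ)⁻¹ * ((A n ω).jumps t univ).toReal :=
      fun n ω => by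
    rw [CountingPath.jumps_univ]
    simp [div_eq_inv_mul]
  have hint : ∀ n : ℕ, 0 < n → (n : ℝ)⁻¹ * (intensity (lamn n) t univ).toReal =
      ∫ s in Iic t, lamn n s / n ∂leb := fun n hn => by
    have hset : (Ioc 0 t : Set ℝ≥0) =ᵐ[leb] Iic t := by
      filter_upwards [compl_mem_ae_iff.2 (measure_singleton (μ := leb) 0)] with s hs
      refine propext ⟨fun h => h.2, fun h => ⟨pos_iff_ne_zero.2 hs, h⟩⟩
    rw [intensity, Measure.restrict_apply_univ, rateMeasure_apply_eq (hr n hn) (hr0 n hn)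
      measurableSet_Ioc Ioc_subset_Iic_self, integral_div, setIntegral_congr_set hset,
      ENNReal.toReal_ofReal (integral_nonneg (hr0 n hn)), div_eq_inv_mul]
  set X : ℕ → Ω → ℝ := fun n ω => (n : ℝ)⁻¹ * ((A n ω).jumps t univ).toReal with hXdef
  have hp : ∀ᶠ n in atTop, MemLp (X n) 2 P := by
    filter_upwards [eventually_gt_atTop 0] with n hn
    exact ((hA n hn).memLp_jumps (hr n hn) (hr0 n hn) t MeasurableSet.univ).const_mul _
  have hmean : Tendsto (fun n => ∫ ω, X n ω ∂P) atTop (𝓝 l) := by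
    refine hlim.congr' ?_
    filter_upwards [eventually_gt_atTop 0] with n hn
    rw [hXdef, integral_const_mul,
      (hA n hn).integral_jumps (hr n hn) (hr0 n hn) t MeasurableSet.univ, hint n hn]
  have hvar : Tendsto (fun n => Var[X n; P]) atTop (𝓝 0) := by
    have := hlim.mul (tendsto_inv_atTop_nhds_zero_nat (𝕜 := ℝ))
    rw [mul_zero] at this
    refine this.congr' ?_
    filter_upwards [eventually_gt_atTop 0] with n hn
    rw [hXdef, variance_const_mul,
      (hA n hn).variance_jumps (hr n hn) (hr0 n hn) t MeasurableSet.univ, ← hint n hn]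
    ring
  filter_upwards [eventually_whp_of_variance hp hmean hvar hε] with z hz
  rw [hX]
  exact hz

end Laws

/-! ### Path regularity -/

/-- The condition on f s covers the default value of `Function.leftLim`, taken at s = 0 and wherever
no left limit exists. -/
theorem leftLim_mem_of_isClosed {C : Set ℝ} (hC : IsClosed C) {f : ℝ≥0 → ℝ} {s : ℝ≥0}
    (h : ∀ᶠ u in 𝓝[<] s, f u ∈ C) (hs : f s ∈ C) : Function.leftLim f s ∈ C := by
  by_cases hbot : 𝓝[<] s = ⊥
  · rwa [leftLim_eq_of_eq_bot f hbot]
  have : (𝓝[<] s).NeBot := ⟨hbot⟩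
  by_cases hlim : ∃ y, Tendsto f (𝓝[<] s) (𝓝 y)
  · obtain ⟨y, hy⟩ := hlim
    rw [leftLim_eq_of_tendsto hy]
    exact hC.mem_of_tendsto hy h
  · rwa [leftLim_eq_of_not_tendsto f hlim]

theorem leftLim_nonneg {f : ℝ≥0 → ℝ} (hf : ∀ t, 0 ≤ f t) (s : ℝ≥0) : 0 ≤ Function.leftLim f s :=
  leftLim_mem_of_isClosed (C := Ici 0) isClosed_Ici (Eventually.of_forall hf) (hf s)

/-- Rounding the argument up to a grid of mesh 1 / (m + 1) gives step functions, which converge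
pointwise to f by right continuity. -/
theorem measurable_of_rightContinuous {f : ℝ≥0 → ℝ} (hf : ∀ t, ContinuousWithinAt f (Ici t) t) :
    Measurable f := by
  set d : ℕ → ℝ≥0 → ℝ≥0 := fun m s => ((⌊((m : ℝ≥0) + 1) * s⌋₊ : ℝ≥0) + 1) / ((m : ℝ≥0) + 1)
    with hd
  have hge : ∀ m s, s ≤ d m s := fun m s => by
    rw [hd]
    simp only
    rw [le_div_iff₀ (by positivity), mul_comm]
    exact (Nat.lt_floor_add_one _).le
  have hle : ∀ m s, d m s ≤ s + 1 / ((m : ℝ≥0) + 1) := fun m s => by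
    rw [hd]
    simp only
    rw [div_le_iff₀ (by positivity),
      show (s + 1 / ((m : ℝ≥0) + 1)) * ((m : ℝ≥0) + 1) = ((m : ℝ≥0) + 1) * s + 1 by field_simp]
    gcongr
    exact Nat.floor_le zero_le
  refine measurable_of_tendsto_metrizable (f := fun m s => f (d m s)) (fun m => ?_)
    (tendsto_pi_nhds.2 fun s => ?_)
  · exact (measurable_from_top (f := fun j : ℕ => f (((j : ℝ≥0) + 1) / ((m : ℝ≥0) + 1)))).comp
      (Nat.measurable_floor.comp (measurable_const_mul ((m : ℝ≥0) + 1)))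
  · refine (hf s).tendsto.comp (tendsto_nhdsWithin_iff.2 ⟨?_, Eventually.of_forall (hge · s)⟩)
    refine tendsto_of_tendsto_of_tendsto_of_le_of_le tendsto_const_nhds ?_ (hge · s) (hle · s)
    simpa using tendsto_const_nhds.add (tendsto_one_div_add_atTop_nhds_zero_nat (𝕜 := ℝ≥0))

/-! ### Thinning by a function of the state and of the staffing level -/

/-- The number of active clocks, as a function of the state `y` and of the staffing level `κ`. -/
structure IsSelection (φ : ℝ → ℝ → ℝ) : Prop where
  continuous : Continuous (Function.uncurry φ)
  mono : ∀ κ, Monotone fun y => φ y κ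
  lipschitz : ∀ y y' κ, φ y κ ≤ φ y' κ + |y - y'|
  le : ∀ y κ, 0 ≤ κ → φ y κ ≤ y

theorem isSelection_sub : IsSelection fun y κ => y - κ where
  continuous := by fun_prop
  mono κ y y' h := by simpa using h
  lipschitz y y' κ := by linarith [le_abs_self (y - y')]
  le y κ h := by linarith

theorem isSelection_min : IsSelection fun y κ => min y κ where
  continuous := by fun_prop
  mono κ y y' h := min_le_min_right κ h
  lipschitz y y' κ := by
    have h := le_abs_self (y - y')
    rcases min_cases y' κ with h' | h'
    · exact (min_le_left _ _).trans (by linarith)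
    · exact (min_le_right _ _).trans (by linarith [abs_nonneg (y - y')])
  le y κ h := min_le_left _ _

/-- The crude selection in which every customer has a running clock. It dominates the other two at
nonnegative staffing and serves to bound oscillations. -/
theorem isSelection_fst : IsSelection fun y _ => y where
  continuous := by fun_prop
  mono _ _ _ h := h
  lipschitz y y' _ := by linarith [le_abs_self (y - y')]
  le y _ _ := le_rfl

theorem IsSelection.max_lipschitz {φ : ℝ → ℝ → ℝ} (hφ : IsSelection φ) (y y' κ : ℝ) :
    max (φ y κ) 0 ≤ max (φ y' κ) 0 + |y - y'| := by
  refine max_le ((hφ.lipschitz y y' κ).trans ?_) ?_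
  · gcongr
    exact le_max_left _ _
  · exact add_nonneg (le_max_right _ _) (abs_nonneg _)

theorem IsSelection.integrableOn {φ : ℝ → ℝ → ℝ} (hφ : IsSelection φ) {r k : ℝ≥0 → ℝ}
    (hr : LocIntegrable r) (hr0 : ∀ t, 0 ≤ r t) (hk : IsStaffing k) {x : ℝ≥0 → ℝ}
    (hx : AEMeasurable x leb) {S : Set ℝ≥0} (hS : MeasurableSet S) {t : ℝ≥0} (hSt : S ⊆ Iic t)
    {M : ℝ} (hM : ∀ s ∈ S, x s ≤ M) :
    IntegrableOn (fun s => max (φ (x s) (k s)) 0) S (rateMeasure r) := by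
  have hfin : rateMeasure r S < ∞ :=
    (measure_ne_top_of_subset hSt (rateMeasure_Iic_ne_top hr hr0 t)).lt_top
  have hm : AEMeasurable (fun s => max (φ (x s) (k s)) 0) leb :=
    (hφ.continuous.measurable.comp_aemeasurable (hx.prodMk hk.measurable)).max aemeasurable_const
  refine Measure.integrableOn_of_bounded (M := |M|) hfin.ne
    (hm.mono_ac (rateMeasure_absolutelyContinuous r)).aestronglyMeasurable ?_
  filter_upwards [ae_restrict_mem hS] with s hs
  rw [Real.norm_of_nonneg (le_max_right _ _)]
  exact max_le ((hφ.le _ _ (hk.nonneg s)).trans ((hM s hs).trans (le_abs_self M))) (abs_nonneg M)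

theorem IsSelection.setIntegral_le {φ : ℝ → ℝ → ℝ} (hφ : IsSelection φ) {r k : ℝ≥0 → ℝ}
    (hr : LocIntegrable r) (hr0 : ∀ t, 0 ≤ r t) (hk : IsStaffing k) {x : ℝ≥0 → ℝ}
    (hx : AEMeasurable x leb) {a b : ℝ≥0} {M : ℝ} (hM0 : 0 ≤ M) (hM : ∀ s ∈ Ioc a b, x s ≤ M) :
    ∫ s in Ioc a b, max (φ (x s) (k s)) 0 ∂(rateMeasure r) ≤
      M * (rateMeasure r (Ioc a b)).toReal := by
  have hfin : rateMeasure r (Ioc a b) ≠ ∞ :=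
    measure_ne_top_of_subset Ioc_subset_Iic_self (rateMeasure_Iic_ne_top hr hr0 b)
  calc ∫ s in Ioc a b, max (φ (x s) (k s)) 0 ∂(rateMeasure r)
      ≤ ∫ s in Ioc a b, M ∂(rateMeasure r) :=
        setIntegral_mono_on (hφ.integrableOn hr hr0 hk hx measurableSet_Ioc Ioc_subset_Iic_self hM)
          (integrableOn_const hfin) measurableSet_Ioc fun s hs =>
            max_le ((hφ.le _ _ (hk.nonneg s)).trans (hM s hs)) hM0
    _ = _ := by
      rw [setIntegral_const, smul_eq_mul, mul_comm]
      rfl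

section Families

variable {Ω : Type*} [MeasurableSpace Ω] {P : Measure Ω}

/-- For each `n ≥ 1`, a sequence of pairwise independent Poisson processes of rate `r`. -/
structure IsPoissonFamily (P : Measure Ω) (N : ℕ → ℕ → Ω → CountingPath) (r : ℝ≥0 → ℝ) :
    Prop where
  integrable : LocIntegrable r
  nonneg : ∀ t, 0 ≤ r t
  poisson : ∀ n, 0 < n → ∀ i, IsPoissonProcess (N n i) r P
  indep : ∀ n, 0 < n → ∀ i j, i ≠ j → Indep (pathSigma (N n i)) (pathSigma (N n j)) P

/-- The staffing levels `K n`, rescaled by `n`, converge to `k`. -/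
structure IsStaffingLimit (K : ℕ → ℝ≥0 → ℝ) (k : ℝ≥0 → ℝ) : Prop where
  staffing : ∀ n, 0 < n → IsStaffing (K n)
  limit : IsStaffing k
  tendsto : ∀ t, Tendsto (fun n : ℕ => K n t / n) atTop (𝓝 (k t))

variable [IsProbabilityMeasure P] {N : ℕ → ℕ → Ω → CountingPath} {r k : ℝ≥0 → ℝ}
  {K : ℕ → ℝ≥0 → ℝ} {φ : ℝ → ℝ → ℝ}

/-- Freezing the state at `y` makes the level deterministic, with the bound n y from
`IsSelection.le`. The left limits of the staffing level may be replaced by its values, from which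
they differ on a countable set only. -/
theorem IsPoissonFamily.eventually_thinned_const (hN : IsPoissonFamily P N r)
    (hK : IsStaffingLimit K k) (hφ : IsSelection φ) (a b : ℝ≥0) (y : ℝ) {ε : ℝ} (hε : 0 < ε) :
    ∀ᶠ z in whp P, |(thinned (fun i => N z.1 i z.2)
      (fun s => z.1 * φ y (Function.leftLim (K z.1) s / z.1)) (Ioc a b)).toReal / z.1 -
        ∫ s in Ioc a b, max (φ y (k s)) 0 ∂(rateMeasure r)| < ε := by
  have hcont : ∀ y, Continuous fun κ => φ y κ := fun y =>
    hφ.continuous.comp (Continuous.prodMk continuous_const continuous_id)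
  refine thinned_law_of_large_numbers hN.integrable hN.nonneg hN.poisson hN.indep
    (h := fun n s => n * φ y (Function.leftLim (K n) s / n)) (g := fun s => φ y (k s)) (M := y)
    (fun n hn => ?_) ?_ (fun n hn s _ => ?_) hε
  · refine AEMeasurable.const_mul ?_ _
    refine (hcont y).measurable.comp_aemeasurable (AEMeasurable.div_const ?_ _)
    exact (hK.staffing n hn).measurable.congr ((ae_leftLim_eq (K n)).mono fun s hs => hs.symm)
  · filter_upwards [ae_all_iff.2 fun n => ae_leftLim_eq (K n)] with s hs _
    refine (((hcont y).tendsto (k s)).comp (hK.tendsto s)).congr' ?_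
    filter_upwards [eventually_gt_atTop 0] with n hn
    have : (n : ℝ) ≠ 0 := by positivity
    simp only [Function.comp_apply]
    rw [hs n]
    field_simp
  · gcongr
    exact hφ.le _ _ (div_nonneg (leftLim_nonneg (hK.staffing n hn).nonneg s) (by positivity))

/-- On an interval on which the state is nearly constant, the thinned processes are close to
their compensators. -/
theorem IsPoissonFamily.eventually_thinned (hN : IsPoissonFamily P N r)
    (hK : IsStaffingLimit K k) (hφ : IsSelection φ) {a b : ℝ≥0} {x xl : ℕ × Ω → ℝ≥0 → ℝ}
    (hx : ∀ᶠ z in whp P, AEMeasurable (x z) leb) {M δ η : ℝ} (hδ : 0 < δ) (hη : 0 < η)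
    (hxM : ∀ᶠ z in whp P, 0 ≤ x z a ∧ x z a ≤ M)
    (hosc : ∀ᶠ z in whp P, ∀ s ∈ Ioc a b, |x z s - x z a| ≤ δ ∧ |xl z s - x z a| ≤ δ) :
    ∀ᶠ z in whp P, |(thinned (fun i => N z.1 i z.2)
      (fun s => z.1 * φ (xl z s) (Function.leftLim (K z.1) s / z.1)) (Ioc a b)).toReal / z.1 -
        ∫ s in Ioc a b, max (φ (x z s) (k s)) 0 ∂(rateMeasure r)| ≤
      3 * δ * (rateMeasure r (Ioc a b)).toReal + η := by
  -- The random state x_a lies in some cell [l δ, (l + 1) δ]. The levels (l - 1) δ and (l + 2) δ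
  -- then bracket the state over the whole interval, and only finitely many deterministic levels
  -- occur.
  have hgrid : ∀ᶠ z in whp P, ∀ l ∈ Finset.range (⌊M / δ⌋₊ + 1), ∀ c ∈ ({-1, 2} : Finset ℝ),
      |(thinned (fun i => N z.1 i z.2) (fun s => z.1 * φ ((l + c) * δ)
        (Function.leftLim (K z.1) s / z.1)) (Ioc a b)).toReal / z.1 -
        ∫ s in Ioc a b, max (φ ((l + c) * δ) (k s)) 0 ∂(rateMeasure r)| < η := by
    rw [eventually_all_finset]
    intro l _
    rw [eventually_all_finset]
    intro c _
    exact hN.eventually_thinned_const hK hφ a b _ hη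
  filter_upwards [eventually_whp_pos, hgrid, hx, hxM, hosc] with z hz hgrid hx hxM hosc
  have hz' : (0 : ℝ) < z.1 := by exact_mod_cast hz
  set l := ⌊x z a / δ⌋₊ with hl
  have hl1 : l * δ ≤ x z a := by
    rw [← le_div_iff₀ hδ]
    exact Nat.floor_le (div_nonneg hxM.1 hδ.le)
  have hl2 : x z a ≤ (l + 1) * δ := by
    rw [← div_le_iff₀ hδ]
    exact (Nat.lt_floor_add_one _).le
  have hlmem : l ∈ Finset.range (⌊M / δ⌋₊ + 1) := by
    rw [Finset.mem_range, Nat.lt_succ_iff]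
    exact Nat.floor_le_floor (by gcongr; exact hxM.2)
  have hlo := hgrid l hlmem (-1) (by simp)
  have hup := hgrid l hlmem 2 (by simp)
  rw [abs_lt] at hlo hup
  set ν := rateMeasure r with hν
  have hνfin : ν (Ioc a b) ≠ ∞ :=
    measure_ne_top_of_subset Ioc_subset_Iic_self (rateMeasure_Iic_ne_top hN.integrable hN.nonneg b)
  have hintc : ∀ c : ℝ, IntegrableOn (fun s => max (φ c (k s)) 0) (Ioc a b) ν := fun c =>
    hφ.integrableOn hN.integrable hN.nonneg hK.limit (x := fun _ => c) aemeasurable_const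
      measurableSet_Ioc Ioc_subset_Iic_self (M := c) fun _ _ => le_rfl
  have hintx : IntegrableOn (fun s => max (φ (x z s) (k s)) 0) (Ioc a b) ν :=
    hφ.integrableOn hN.integrable hN.nonneg hK.limit hx
      measurableSet_Ioc Ioc_subset_Iic_self (M := M + δ) fun s hs => by
        have := abs_le.1 (hosc s hs).1
        linarith [hxM.2]
  have hintδ : ∫ s in Ioc a b, 3 * δ ∂ν = 3 * δ * (ν (Ioc a b)).toReal := by
    rw [setIntegral_const, smul_eq_mul, mul_comm]
    rfl
  have hbd : ∀ s ∈ Ioc a b, z.1 * φ (xl z s) (Function.leftLim (K z.1) s / z.1) ≤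
      z.1 * φ ((l + 2) * δ) (Function.leftLim (K z.1) s / z.1) := fun s hs => by
    gcongr
    refine hφ.mono _ ?_
    have := abs_le.1 (hosc s hs).2
    linarith
  have hbd' : ∀ s ∈ Ioc a b, z.1 * φ ((l + -1) * δ) (Function.leftLim (K z.1) s / z.1) ≤
      z.1 * φ (xl z s) (Function.leftLim (K z.1) s / z.1) := fun s hs => by
    gcongr
    refine hφ.mono _ ?_
    have := abs_le.1 (hosc s hs).2
    linarith
  have htop : ∀ c : ℝ, thinned (fun i => N z.1 i z.2)
      (fun s => z.1 * φ c (Function.leftLim (K z.1) s / z.1)) (Ioc a b) ≠ ∞ := fun c =>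
    thinned_ne_top _ (c := z.1 * c) fun s _ => by
      gcongr
      exact hφ.le _ _ (div_nonneg (leftLim_nonneg (hK.staffing z.1 hz).nonneg s) hz'.le)
  have h1 : (thinned (fun i => N z.1 i z.2)
      (fun s => z.1 * φ (xl z s) (Function.leftLim (K z.1) s / z.1)) (Ioc a b)).toReal / z.1 ≤
      (thinned (fun i => N z.1 i z.2) (fun s => z.1 * φ ((l + 2) * δ)
        (Function.leftLim (K z.1) s / z.1)) (Ioc a b)).toReal / z.1 := by
    gcongr
    · exact htop _
    · exact thinned_mono _ hbd
  have h2 : (thinned (fun i => N z.1 i z.2) (fun s => z.1 * φ ((l + -1) * δ)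
        (Function.leftLim (K z.1) s / z.1)) (Ioc a b)).toReal / z.1 ≤
      (thinned (fun i => N z.1 i z.2)
      (fun s => z.1 * φ (xl z s) (Function.leftLim (K z.1) s / z.1)) (Ioc a b)).toReal / z.1 := by
    gcongr
    · exact ne_top_of_le_ne_top (htop _) (thinned_mono _ hbd)
    · exact thinned_mono _ hbd'
  -- The bracket has length 3 δ, which bounds the distance of x from either end.
  have h3 : ∫ s in Ioc a b, max (φ ((l + 2) * δ) (k s)) 0 ∂ν ≤
      (∫ s in Ioc a b, max (φ (x z s) (k s)) 0 ∂ν) + 3 * δ * (ν (Ioc a b)).toReal := by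
    rw [← hintδ, ← integral_add hintx (integrableOn_const hνfin)]
    refine setIntegral_mono_on (hintc _) (hintx.add (integrableOn_const hνfin))
      measurableSet_Ioc fun s hs => ?_
    refine (hφ.max_lipschitz _ (x z s) (k s)).trans ?_
    have := abs_le.1 (hosc s hs).1
    gcongr
    rw [abs_le]
    constructor <;> linarith
  have h4 : ∫ s in Ioc a b, max (φ (x z s) (k s)) 0 ∂ν ≤
      (∫ s in Ioc a b, max (φ ((l + -1) * δ) (k s)) 0 ∂ν) + 3 * δ * (ν (Ioc a b)).toReal := by
    rw [← hintδ, ← integral_add (hintc _) (integrableOn_const hνfin)]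
    refine setIntegral_mono_on hintx ((hintc _).add (integrableOn_const hνfin))
      measurableSet_Ioc fun s hs => ?_
    refine (hφ.max_lipschitz _ ((l + -1) * δ) (k s)).trans ?_
    have := abs_le.1 (hosc s hs).1
    gcongr
    rw [abs_le]
    constructor <;> linarith
  rw [abs_le]
  constructor <;> linarith [hlo.1, hup.2]

end Families

/-! ### The fluid equation -/

/-- The right-hand side of the fluid equation. -/
noncomputable def fluidMap (q₀ : ℝ) (lam theta mu k x : ℝ≥0 → ℝ) (t : ℝ≥0) : ℝ :=
  q₀ + (∫ s in Iic t, lam s ∂leb) - (∫ s in Iic t, theta s * max (x s - k s) 0 ∂leb)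
    - ∫ s in Iic t, mu s * min (x s) (k s) ∂leb

/-- Both integrals in the fluid equation are finite. -/
structure IsAdmissible (theta mu k x : ℝ≥0 → ℝ) : Prop where
  abandonment : LocIntegrable (fun s => theta s * max (x s - k s) 0)
  service : LocIntegrable (fun s => mu s * min (x s) (k s))

theorem LocIntegrable.mul_locallyBounded {r f : ℝ≥0 → ℝ} (hr : LocIntegrable r)
    (hf : AEMeasurable f leb) (hb : ∀ t, ∃ b, ∀ s ≤ t, |f s| ≤ b) :
    LocIntegrable fun s => r s * f s := by
  intro t
  obtain ⟨b, hb⟩ := hb t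
  refine Integrable.mul_bdd (c := b) (hr t) hf.aestronglyMeasurable.restrict ?_
  filter_upwards [ae_restrict_mem measurableSet_Iic] with s hs using hb s hs

theorem IsAdmissible.of_locallyBounded {theta mu k x : ℝ≥0 → ℝ} (htheta : LocIntegrable theta)
    (hmu : LocIntegrable mu) (hk : IsStaffing k) (hx : AEMeasurable x leb)
    (hb : ∀ t, ∃ b, ∀ s ≤ t, |x s| ≤ b) : IsAdmissible theta mu k x where
  abandonment := by
    refine htheta.mul_locallyBounded ((hx.sub hk.measurable).max aemeasurable_const) fun t => ?_
    obtain ⟨b, hb⟩ := hb t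
    refine ⟨b, fun s hs => ?_⟩
    rw [abs_of_nonneg (le_max_right _ _)]
    have h1 := abs_le.1 (hb s hs)
    exact max_le (by linarith [hk.nonneg s]) ((abs_nonneg _).trans (hb s hs))
  service := by
    refine hmu.mul_locallyBounded (hx.min hk.measurable) fun t => ?_
    obtain ⟨b, hb⟩ := hb t
    refine ⟨b, fun s hs => ?_⟩
    have h1 := abs_le.1 (hb s hs)
    have h2 := hk.nonneg s
    rw [abs_le]
    exact ⟨le_min h1.1 (by linarith), (min_le_left _ _).trans h1.2⟩

theorem ofReal_abs_sub_integral_le {r : ℝ≥0 → ℝ} (hr : LocIntegrable r) (hr0 : ∀ t, 0 ≤ r t)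
    {f g : ℝ≥0 → ℝ} {u : ℝ≥0 → ℝ≥0∞} {t : ℝ≥0} (hf : IntegrableOn (fun s => r s * f s) (Iic t) leb)
    (hg : IntegrableOn (fun s => r s * g s) (Iic t) leb)
    (h : ∀ s ≤ t, ENNReal.ofReal |f s - g s| ≤ u s) :
    ENNReal.ofReal |(∫ s in Iic t, r s * f s ∂leb) - ∫ s in Iic t, r s * g s ∂leb| ≤
      ∫⁻ s in Iic t, u s ∂(rateMeasure r) := by
  have hf' := (integrableOn_rateMeasure_iff hr hr0 measurableSet_Iic).2 hf
  have hg' := (integrableOn_rateMeasure_iff hr hr0 measurableSet_Iic).2 hg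
  rw [← setIntegral_rateMeasure hr hr0 f measurableSet_Iic,
    ← setIntegral_rateMeasure hr hr0 g measurableSet_Iic, ← integral_sub hf' hg',
    ← Real.enorm_eq_ofReal_abs]
  refine (enorm_integral_le_lintegral_enorm _).trans
    (setLIntegral_mono' measurableSet_Iic fun s hs => ?_)
  rw [Real.enorm_eq_ofReal_abs]
  exact h s hs

theorem abs_max_sub_max_le (x y κ : ℝ) : |max (x - κ) 0 - max (y - κ) 0| ≤ |x - y| := by
  refine (abs_max_sub_max_le_abs _ _ _).trans_eq ?_
  congr 1
  ring

theorem abs_min_sub_min_le (x y κ : ℝ) : |min x κ - min y κ| ≤ |x - y| := by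
  have := isSelection_min.lipschitz x y κ
  have := isSelection_min.lipschitz y x κ
  rw [abs_sub_comm y x] at this
  rw [abs_le]
  constructor <;> linarith

section Fluid

variable {q₀ : ℝ} {lam theta mu k : ℝ≥0 → ℝ}

/-- The arrival terms cancel and both departure rates are 1-Lipschitz in the state, which is the
form that Gronwall's inequality requires. -/
theorem ofReal_abs_fluidMap_sub_le (htheta0 : ∀ t, 0 ≤ theta t) (htheta : LocIntegrable theta)
    (hmu0 : ∀ t, 0 ≤ mu t) (hmu : LocIntegrable mu) {x y : ℝ≥0 → ℝ}
    (hx : IsAdmissible theta mu k x) (hy : IsAdmissible theta mu k y) (t : ℝ≥0) :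
    ENNReal.ofReal |fluidMap q₀ lam theta mu k x t - fluidMap q₀ lam theta mu k y t| ≤
      ∫⁻ s in Iic t, ENNReal.ofReal |x s - y s| ∂(rateMeasure theta + rateMeasure mu) := by
  have h1 := ofReal_abs_sub_integral_le htheta htheta0 (hx.abandonment t) (hy.abandonment t)
    (u := fun s => ENNReal.ofReal |x s - y s|)
    (fun s _ => ENNReal.ofReal_le_ofReal (abs_max_sub_max_le _ _ _))
  have h2 := ofReal_abs_sub_integral_le hmu hmu0 (hx.service t) (hy.service t)
    (u := fun s => ENNReal.ofReal |x s - y s|)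
    (fun s _ => ENNReal.ofReal_le_ofReal (abs_min_sub_min_le _ _ _))
  rw [Measure.restrict_add, lintegral_add_measure]
  refine le_trans ?_ (add_le_add h1 h2)
  rw [← ENNReal.ofReal_add (abs_nonneg _) (abs_nonneg _)]
  refine ENNReal.ofReal_le_ofReal ?_
  rw [fluidMap, fluidMap]
  refine le_trans (le_of_eq ?_) (abs_add_le _ _)
  rw [← abs_neg]
  congr 1
  ring

theorem rateMeasure_add_Iic_ne_top (htheta0 : ∀ t, 0 ≤ theta t) (htheta : LocIntegrable theta)
    (hmu0 : ∀ t, 0 ≤ mu t) (hmu : LocIntegrable mu) (t : ℝ≥0) :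
    (rateMeasure theta + rateMeasure mu) (Iic t) ≠ ∞ :=
  ENNReal.add_ne_top.2
    ⟨rateMeasure_Iic_ne_top htheta htheta0 t, rateMeasure_Iic_ne_top hmu hmu0 t⟩

instance (theta mu : ℝ≥0 → ℝ) : NullSingletonClass (rateMeasure theta + rateMeasure mu) where
  measure_singleton x := by simp

/-- Approximate solutions of the fluid equation are close to each other. -/
theorem exists_fluid_stability_const (htheta0 : ∀ t, 0 ≤ theta t) (htheta : LocIntegrable theta)
    (hmu0 : ∀ t, 0 ≤ mu t) (hmu : LocIntegrable mu) (T : ℝ≥0) :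
    ∃ C : ℝ, 0 ≤ C ∧ ∀ (x y : ℝ≥0 → ℝ) (e b : ℝ), IsAdmissible theta mu k x →
      IsAdmissible theta mu k y → (∀ t ≤ T, |x t - y t| ≤ b) →
      (∀ t ≤ T, |x t - fluidMap q₀ lam theta mu k x t| +
        |y t - fluidMap q₀ lam theta mu k y t| ≤ e) → ∀ t ≤ T, |x t - y t| ≤ C * e := by
  obtain ⟨C, hC, h⟩ := exists_gronwall_const (rateMeasure theta + rateMeasure mu)
    (rateMeasure_add_Iic_ne_top htheta0 htheta hmu0 hmu) T
  refine ⟨C.toReal, ENNReal.toReal_nonneg, fun x y e b hx hy hb he t ht => ?_⟩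
  have he0 : 0 ≤ e := le_trans (by positivity) (he t ht)
  have := h (fun s => ENNReal.ofReal |x s - y s|) (ENNReal.ofReal e) (ENNReal.ofReal b)
    ENNReal.ofReal_ne_top (fun s hs => ENNReal.ofReal_le_ofReal (hb s hs)) (fun s hs => ?_) t ht
  · rw [← ENNReal.ofReal_toReal hC, ← ENNReal.ofReal_mul ENNReal.toReal_nonneg] at this
    exact (ENNReal.ofReal_le_ofReal_iff (mul_nonneg ENNReal.toReal_nonneg he0)).1 this
  -- Decompose x - y as (x - F x) + (F x - F y) - (y - F y), with F the fluid map.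
  · refine le_trans ?_ (add_le_add_right
      (ofReal_abs_fluidMap_sub_le (q₀ := q₀) (lam := lam) htheta0 htheta hmu0 hmu hx hy s) _)
    rw [← ENNReal.ofReal_add he0 (abs_nonneg _)]
    refine ENNReal.ofReal_le_ofReal (le_trans ?_ (add_le_add_left (he s hs) _))
    set X := fluidMap q₀ lam theta mu k x s
    set Y := fluidMap q₀ lam theta mu k y s
    calc |x s - y s| = |(x s - X) + (X - Y) - (y s - Y)| := by congr 1; ring
      _ ≤ |x s - X| + |X - Y| + |y s - Y| :=
        (abs_sub _ _).trans (add_le_add_left (abs_add_le _ _) _)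
      _ = _ := by ring

theorem LocIntegrable.abs_integral_le {f : ℝ≥0 → ℝ} (hf : LocIntegrable f) {t T : ℝ≥0}
    (ht : t ≤ T) : |∫ s in Iic t, f s ∂leb| ≤ ∫ s in Iic T, |f s| ∂leb :=
  (norm_integral_le_integral_norm _).trans (setIntegral_mono_set (hf T).norm
    (ae_of_all _ fun _ => norm_nonneg _) (Iic_subset_Iic.2 ht).eventuallyLE)

/-- Supplies the a priori bound in Gronwall's inequality: each integral is dominated by that of its
absolute value up to t. -/
theorem IsFluidSolution.locallyBounded {q : ℝ≥0 → ℝ} (hlam : LocIntegrable lam)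
    (hq : IsFluidSolution q₀ lam theta mu k q) (t : ℝ≥0) : ∃ b, ∀ s ≤ t, |q s| ≤ b := by
  refine ⟨|q₀| + (∫ s in Iic t, |lam s| ∂leb) +
    (∫ s in Iic t, |theta s * max (q s - k s) 0| ∂leb) +
      ∫ s in Iic t, |mu s * min (q s) (k s)| ∂leb, fun s hs => ?_⟩
  rw [hq.equation s]
  refine (abs_sub _ _).trans (add_le_add ((abs_sub _ _).trans
    (add_le_add ((abs_add_le _ _).trans (add_le_add_right ?_ _)) ?_)) ?_)
  · exact hlam.abs_integral_le hs
  · exact hq.integrable_abandonment.abs_integral_le hs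
  · exact hq.integrable_service.abs_integral_le hs

theorem IsFluidSolution.isAdmissible {q : ℝ≥0 → ℝ} (hq : IsFluidSolution q₀ lam theta mu k q) :
    IsAdmissible theta mu k q :=
  ⟨hq.integrable_abandonment, hq.integrable_service⟩

theorem IsFluidSolution.eq_fluidMap {q : ℝ≥0 → ℝ} (hq : IsFluidSolution q₀ lam theta mu k q)
    (t : ℝ≥0) : q t = fluidMap q₀ lam theta mu k q t :=
  hq.equation t

theorem IsFluidSolution.unique (hlam : LocIntegrable lam) (htheta0 : ∀ t, 0 ≤ theta t)
    (htheta : LocIntegrable theta) (hmu0 : ∀ t, 0 ≤ mu t) (hmu : LocIntegrable mu)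
    {q q' : ℝ≥0 → ℝ} (hq : IsFluidSolution q₀ lam theta mu k q)
    (hq' : IsFluidSolution q₀ lam theta mu k q') : q' = q := by
  funext t
  obtain ⟨C, -, hC⟩ := exists_fluid_stability_const (q₀ := q₀) (lam := lam) (k := k)
    htheta0 htheta hmu0 hmu t
  obtain ⟨b, hb⟩ := hq.locallyBounded hlam t
  obtain ⟨b', hb'⟩ := hq'.locallyBounded hlam t
  have := hC q' q 0 (b' + b) hq'.isAdmissible hq.isAdmissible
    (fun s hs => (abs_sub _ _).trans (add_le_add (hb' s hs) (hb s hs)))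
    (fun s _ => by rw [← hq.eq_fluidMap, ← hq'.eq_fluidMap]; simp) t le_rfl
  rw [mul_zero] at this
  exact sub_eq_zero.1 (abs_nonpos_iff.1 this)

/-- The fluid equation has a solution as soon as it has approximate solutions. -/
theorem exists_isFluidSolution (htheta0 : ∀ t, 0 ≤ theta t) (htheta : LocIntegrable theta)
    (hmu0 : ∀ t, 0 ≤ mu t) (hmu : LocIntegrable mu) (hk : IsStaffing k)
    (happrox : ∀ (T : ℝ≥0) (ε : ℝ), 0 < ε → ∃ x : ℝ≥0 → ℝ, Measurable x ∧
      (∀ t, ∃ b, ∀ s ≤ t, |x s| ≤ b) ∧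
      ∀ t ≤ T, |x t - fluidMap q₀ lam theta mu k x t| ≤ ε) :
    ∃ q, IsFluidSolution q₀ lam theta mu k q := by
  choose x hxm hxb hxe using fun m : ℕ =>
    happrox (m : ℝ≥0) (1 / ((m : ℝ) + 1)) Nat.one_div_pos_of_nat
  have hadm : ∀ m, IsAdmissible theta mu k (x m) := fun m =>
    .of_locallyBounded htheta hmu hk (hxm m).aemeasurable (hxb m)
  -- From index N ≥ T on, each residual on [0, T] is at most 1 / (N + 1); two of them enter the
  -- stability estimate.
  have hcauchy : ∀ T : ℕ, ∃ C : ℝ, 0 ≤ C ∧ ∀ N l m : ℕ, T ≤ N → N ≤ l → N ≤ m → ∀ t ≤ (T : ℝ≥0),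
      |x l t - x m t| ≤ C * (2 * (1 / ((N : ℝ) + 1))) := by
    intro T
    obtain ⟨C, hC0, hC⟩ := exists_fluid_stability_const (q₀ := q₀) (lam := lam) (k := k)
      htheta0 htheta hmu0 hmu T
    refine ⟨C, hC0, fun N l m hTN hl hm t ht => ?_⟩
    obtain ⟨b, hb⟩ := hxb l T
    obtain ⟨b', hb'⟩ := hxb m T
    refine hC (x l) (x m) _ (b + b') (hadm l) (hadm m)
      (fun s hs => (abs_sub _ _).trans (add_le_add (hb s hs) (hb' s hs))) (fun s hs => ?_) t ht
    have hl' := hxe l s (hs.trans (by exact_mod_cast hTN.trans hl))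
    have hm' := hxe m s (hs.trans (by exact_mod_cast hTN.trans hm))
    have h1 : 1 / ((l : ℝ) + 1) ≤ 1 / ((N : ℝ) + 1) := Nat.one_div_le_one_div hl
    have h2 : 1 / ((m : ℝ) + 1) ≤ 1 / ((N : ℝ) + 1) := Nat.one_div_le_one_div hm
    linarith
  choose C hC0 hC using hcauchy
  have hzero : ∀ c : ℝ, Tendsto (fun N : ℕ => c * (2 * (1 / ((N : ℝ) + 1)))) atTop (𝓝 0) :=
    fun c => by simpa using (tendsto_one_div_add_atTop_nhds_zero_nat (𝕜 := ℝ)).const_mul 2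
      |>.const_mul c
  have hlim : ∀ t, ∃ l, Tendsto (fun m => x m t) atTop (𝓝 l) := by
    intro t
    obtain ⟨T, hT⟩ := exists_nat_ge t
    have hc : CauchySeq fun m => x (m + T) t := by
      refine cauchySeq_of_le_tendsto_0 _ (fun n m N hn hm => ?_)
        ((hzero (C T)).comp (tendsto_add_atTop_nat T))
      exact hC T (N + T) (n + T) (m + T) (by omega) (by omega) (by omega) t hT
    obtain ⟨l, hl⟩ := cauchySeq_tendsto_of_complete hc
    exact ⟨l, (tendsto_add_atTop_iff_nat T).1 hl⟩
  choose q hq using hlim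
  have hdist : ∀ T N : ℕ, T ≤ N → ∀ t ≤ (T : ℝ≥0),
      |x N t - q t| ≤ C T * (2 * (1 / ((N : ℝ) + 1))) := by
    intro T N hTN t ht
    refine le_of_tendsto ((tendsto_const_nhds.sub (hq t)).abs) ?_
    filter_upwards [eventually_ge_atTop N] with m hm
    exact hC T N N m hTN le_rfl hm t ht
  have hqm : Measurable q := measurable_of_tendsto_metrizable hxm (tendsto_pi_nhds.2 hq)
  have hqb : ∀ t, ∃ b, ∀ s ≤ t, |q s| ≤ b := by
    intro t
    obtain ⟨T, hT⟩ := exists_nat_ge t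
    obtain ⟨b, hb⟩ := hxb T t
    refine ⟨b + C T * (2 * (1 / ((T : ℝ) + 1))), fun s hs => ?_⟩
    have h1 := hb s hs
    have h2 := hdist T T le_rfl s (hs.trans hT)
    have h3 := abs_sub_abs_le_abs_sub (q s) (x T s)
    rw [abs_sub_comm] at h3
    linarith
  have hqadm : IsAdmissible theta mu k q := .of_locallyBounded htheta hmu hk hqm.aemeasurable hqb
  refine ⟨q, hqadm.abandonment, hqadm.service, fun t => ?_⟩
  obtain ⟨T, hT⟩ := exists_nat_ge t
  set ρ := rateMeasure theta + rateMeasure mu with hρ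
  have hρt : ρ (Iic t) ≠ ∞ := rateMeasure_add_Iic_ne_top htheta0 htheta hmu0 hmu t
  -- The residual of q is split through x_N: two terms from the distance of q to x_N, one of them
  -- under the fluid map, and the residual of x_N.
  have hbound : ∀ N, T ≤ N → |q t - fluidMap q₀ lam theta mu k q t| ≤
      C T * (2 * (1 / ((N : ℝ) + 1))) * (1 + (ρ (Iic t)).toReal) + 1 / ((N : ℝ) + 1) := by
    intro N hN
    set c := C T * (2 * (1 / ((N : ℝ) + 1))) with hc
    have hc0 : 0 ≤ c := mul_nonneg (hC0 T) (by positivity)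
    have h1 := hdist T N hN t hT
    have h2 := hxe N t (hT.trans (by exact_mod_cast hN))
    have h3 : |fluidMap q₀ lam theta mu k (x N) t - fluidMap q₀ lam theta mu k q t| ≤
        c * (ρ (Iic t)).toReal := by
      have := (ofReal_abs_fluidMap_sub_le (q₀ := q₀) (lam := lam) htheta0 htheta hmu0 hmu
        (hadm N) hqadm t).trans (setLIntegral_mono' measurableSet_Iic fun s hs =>
          ENNReal.ofReal_le_ofReal (hdist T N hN s (le_trans hs hT)))
      rw [setLIntegral_const, ← hc, ← hρ, ← ENNReal.ofReal_toReal hρt,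
        ← ENNReal.ofReal_mul hc0] at this
      exact (ENNReal.ofReal_le_ofReal_iff (by positivity)).1 this
    rw [abs_le] at *
    constructor <;> linarith
  have hlim0 : Tendsto (fun N : ℕ => C T * (2 * (1 / ((N : ℝ) + 1))) * (1 + (ρ (Iic t)).toReal) +
      1 / ((N : ℝ) + 1)) atTop (𝓝 0) := by
    simpa using ((hzero (C T)).mul_const (1 + (ρ (Iic t)).toReal)).add
      (tendsto_one_div_add_atTop_nhds_zero_nat (𝕜 := ℝ))
  have h0 : |q t - fluidMap q₀ lam theta mu k q t| ≤ 0 :=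
    ge_of_tendsto hlim0 ((eventually_ge_atTop T).mono hbound)
  exact sub_eq_zero.1 (abs_nonpos_iff.1 h0)

end Fluid

/-! ### The rescaled queues approximately solve the fluid equation -/

theorem exists_mem_Ioc_of_monotone {τ : ℕ → ℝ≥0} (m : ℕ) {t : ℝ≥0} (ht : t ≤ τ m) :
    t ≤ τ 0 ∨ ∃ j < m, t ∈ Ioc (τ j) (τ (j + 1)) := by
  induction m with
  | zero => exact Or.inl ht
  | succ m ih =>
    rcases le_or_gt t (τ m) with h | h
    · rcases ih h with h' | ⟨j, hj, hjt⟩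
      · exact Or.inl h'
      · exact Or.inr ⟨j, by omega, hjt⟩
    · exact Or.inr ⟨m, by omega, h, ht⟩

theorem restrict_Iic_eq_restrict_Ioc (ρ : Measure ℝ≥0) [NullSingletonClass ρ] (t : ℝ≥0) :
    ρ.restrict (Iic t) = ρ.restrict (Ioc 0 t) := by
  refine Measure.restrict_congr_set ?_
  filter_upwards [compl_mem_ae_iff.2 (measure_singleton (μ := ρ) 0)] with s hs
  exact propext ⟨fun h => ⟨pos_iff_ne_zero.2 hs, h⟩, fun h => h.2⟩

section Families

variable {Ω : Type*} [MeasurableSpace Ω] {P : Measure Ω} [IsProbabilityMeasure P]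
  {N : ℕ → ℕ → Ω → CountingPath} {r k : ℝ≥0 → ℝ} {K : ℕ → ℝ≥0 → ℝ} {φ : ℝ → ℝ → ℝ}

/-- Local errors add up: the masses telescope, and each cell contributes one η. Finiteness of the
total count makes `ENNReal.toReal` additive over the cells. -/
theorem IsPoissonFamily.eventually_compensator (hN : IsPoissonFamily P N r)
    (hK : IsStaffingLimit K k) (hφ : IsSelection φ) {x xl : ℕ × Ω → ℝ≥0 → ℝ} {τ : ℕ → ℝ≥0}
    (hτ : Monotone τ) (hτ0 : τ 0 = 0) {m : ℕ} {M δ η : ℝ} (hδ : 0 < δ) (hη : 0 < η)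
    (hx : ∀ᶠ z in whp P, AEMeasurable (x z) leb)
    (hxM : ∀ᶠ z in whp P, ∀ s ≤ τ m, 0 ≤ x z s ∧ x z s ≤ M)
    (hosc : ∀ j < m, ∀ᶠ z in whp P, ∀ s ∈ Ioc (τ j) (τ (j + 1)),
      |x z s - x z (τ j)| ≤ δ ∧ |xl z s - x z (τ j)| ≤ δ)
    (hfin : ∀ᶠ z in whp P, thinned (fun i => N z.1 i z.2)
      (fun s => z.1 * φ (xl z s) (Function.leftLim (K z.1) s / z.1)) (Ioc 0 (τ m)) ≠ ∞) :
    ∀ᶠ z in whp P, ∀ j ≤ m, |(thinned (fun i => N z.1 i z.2)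
      (fun s => z.1 * φ (xl z s) (Function.leftLim (K z.1) s / z.1)) (Ioc 0 (τ j))).toReal / z.1 -
        ∫ s in Ioc 0 (τ j), max (φ (x z s) (k s)) 0 ∂(rateMeasure r)| ≤
      3 * δ * (rateMeasure r (Iic (τ m))).toReal + m * η := by
  have hlocal : ∀ᶠ z in whp P, ∀ j ∈ Finset.range m, |(thinned (fun i => N z.1 i z.2)
      (fun s => z.1 * φ (xl z s) (Function.leftLim (K z.1) s / z.1))
        (Ioc (τ j) (τ (j + 1)))).toReal / z.1 -
        ∫ s in Ioc (τ j) (τ (j + 1)), max (φ (x z s) (k s)) 0 ∂(rateMeasure r)| ≤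
      3 * δ * (rateMeasure r (Ioc (τ j) (τ (j + 1)))).toReal + η := by
    rw [eventually_all_finset]
    intro j hj
    exact hN.eventually_thinned hK hφ hx hδ hη
      (hxM.mono fun z hz => hz (τ j) (hτ (Finset.mem_range.1 hj).le))
      (hosc j (Finset.mem_range.1 hj))
  filter_upwards [hlocal, hx, hxM, hfin] with z hlocal hx hxM hfin
  have hνfin := rateMeasure_Iic_ne_top hN.integrable hN.nonneg
  have main : ∀ j ≤ m, |(thinned (fun i => N z.1 i z.2)
      (fun s => z.1 * φ (xl z s) (Function.leftLim (K z.1) s / z.1)) (Ioc 0 (τ j))).toReal / z.1 -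
        ∫ s in Ioc 0 (τ j), max (φ (x z s) (k s)) 0 ∂(rateMeasure r)| ≤
      3 * δ * (rateMeasure r (Iic (τ j))).toReal + j * η := by
    intro j
    induction j with
    | zero =>
      intro _
      simp only [hτ0, Ioc_self, thinned, empty_inter, measure_empty, tsum_zero,
        ENNReal.toReal_zero, zero_div, Measure.restrict_empty, integral_zero_measure, sub_zero,
        abs_zero, Nat.cast_zero, zero_mul, add_zero]
      positivity
    | succ j ih =>
      intro hj
      have hjm : τ (j + 1) ≤ τ m := hτ hj
      have hfin1 := thinned_union (fun i => N z.1 i z.2)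
        (fun s => z.1 * φ (xl z s) (Function.leftLim (K z.1) s / z.1))
        (zero_le (a := τ (j + 1))) hjm
      rw [hfin1] at hfin
      have hfin2 := (ENNReal.add_ne_top.1 hfin).1
      have hun := thinned_union (fun i => N z.1 i z.2)
        (fun s => z.1 * φ (xl z s) (Function.leftLim (K z.1) s / z.1))
        (zero_le (a := τ j)) (hτ j.le_succ)
      rw [hun] at hfin2 ⊢
      have hfin3 := ENNReal.add_ne_top.1 hfin2
      have hint : ∀ a b : ℝ≥0, b ≤ τ m →
          IntegrableOn (fun s => max (φ (x z s) (k s)) 0) (Ioc a b) (rateMeasure r) := fun a b hb =>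
        hφ.integrableOn hN.integrable hN.nonneg hK.limit hx measurableSet_Ioc
          Ioc_subset_Iic_self (M := M) fun s hs => (hxM s (hs.2.trans hb)).2
      rw [ENNReal.toReal_add hfin3.1 hfin3.2, ← Ioc_union_Ioc_eq_Ioc zero_le (hτ j.le_succ),
        setIntegral_union (Ioc_disjoint_Ioc_of_le le_rfl) measurableSet_Ioc
          (hint _ _ ((hτ j.le_succ).trans hjm)) (hint _ _ hjm)]
      have h1 := abs_le.1 (ih (by omega))
      have h2 := hlocal j (Finset.mem_range.2 (by omega))
      rw [measure_Ioc_toReal hνfin (hτ j.le_succ)] at h2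
      have h2 := abs_le.1 h2
      push_cast
      rw [add_div, abs_le]
      constructor <;> linarith
  intro j hj
  refine (main j hj).trans ?_
  gcongr
  · exact hνfin _
  · exact hτ hj

end Families

/-! ### The rescaled queue as a thinning driven by its own left limits -/

section Paths

variable {Ω : Type*}

/-- The rescaled number of customers. -/
noncomputable def scaled (Q : ℕ → ℝ≥0 → Ω → ℕ) (z : ℕ × Ω) (t : ℝ≥0) : ℝ :=
  (Q z.1 t z.2 : ℝ) / z.1

theorem scaled_nonneg (Q : ℕ → ℝ≥0 → Ω → ℕ) (z : ℕ × Ω) (t : ℝ≥0) : 0 ≤ scaled Q z t := by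
  rw [scaled]
  positivity

theorem leftQ_div_mem {C : Set ℝ} (hC : IsClosed C) {z : ℕ × Ω} {a s : ℝ≥0} (has : a < s)
    (h : ∀ u ∈ Ioc a s, scaled Q z u ∈ C) : leftQ (Q z.1) z.2 s / z.1 ∈ C := by
  refine leftLim_mem_of_isClosed (C := (fun v : ℝ => v / z.1) ⁻¹' C)
    (hC.preimage (continuous_id.div_const _)) ?_ (h s ⟨has, le_rfl⟩)
  filter_upwards [Ioo_mem_nhdsLT has] with u hu
  exact h u ⟨hu.1, hu.2.le⟩

theorem abandonments_eq_thinned (K : ℝ≥0 → ℝ) (R : ℕ → Ω → CountingPath) (Q : ℝ≥0 → Ω → ℕ)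
    (t : ℝ≥0) (ω : Ω) {n : ℕ} (hn : 0 < n) :
    abandonments K R Q t ω = thinned (fun i => R i ω)
      (fun s => n * (leftQ Q ω s / n - Function.leftLim K s / n)) (Ioc 0 t) := by
  have hn' : (n : ℝ) ≠ 0 := by positivity
  refine tsum_congr fun i => ?_
  rw [CountingPath.integralOn]
  congr 2
  ext s
  rw [mem_ofPred_eq, mem_ofPred_eq]
  beta_reduce
  rw [mul_sub, mul_div_cancel₀ _ hn', mul_div_cancel₀ _ hn',
    le_sub_iff_add_le, add_comm]

theorem completions_eq_thinned (K : ℝ≥0 → ℝ) (B : ℕ → Ω → CountingPath) (Q : ℝ≥0 → Ω → ℕ)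
    (t : ℝ≥0) (ω : Ω) {n : ℕ} (hn : 0 < n) :
    completions K B Q t ω = thinned (fun i => B i ω)
      (fun s => n * min (leftQ Q ω s / n) (Function.leftLim K s / n)) (Ioc 0 t) := by
  have hn' : (n : ℝ) ≠ 0 := by positivity
  refine tsum_congr fun i => ?_
  rw [CountingPath.integralOn]
  congr 2
  ext s
  rw [mem_ofPred_eq, mem_ofPred_eq]
  beta_reduce
  rw [mul_min_of_nonneg _ _ (by positivity), mul_div_cancel₀ _ hn',
    mul_div_cancel₀ _ hn']

end Paths

/-! ### Balance equation, bounds and oscillation of the rescaled queue -/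

section Queue

variable {Ω : Type*} [MeasurableSpace Ω] {P : Measure Ω}

/-- The finite right-hand side of the balance forces both departure sums to be finite, so the
identity passes to real numbers. -/
theorem IsQueue.ae_balance {lam theta mu K : ℝ≥0 → ℝ} {A : Ω → CountingPath}
    {R B : ℕ → Ω → CountingPath} {Q : ℝ≥0 → Ω → ℕ} (h : IsQueue P lam theta mu K A R B Q) :
    ∀ᵐ ω ∂P, ∀ t, abandonments K R Q t ω ≠ ∞ ∧ completions K B Q t ω ≠ ∞ ∧
      (Q t ω : ℝ) + (abandonments K R Q t ω).toReal + (completions K B Q t ω).toReal =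
        Q 0 ω + A ω t := by
  filter_upwards [h.balance] with ω hω t
  have hsum : (Q t ω : ℝ≥0∞) + abandonments K R Q t ω + completions K B Q t ω ≠ ∞ := by
    rw [hω t]
    finiteness
  have h1 := ENNReal.add_ne_top.1 hsum
  have h2 := ENNReal.add_ne_top.1 h1.1
  refine ⟨h2.2, h1.2, ?_⟩
  have := congrArg ENNReal.toReal (hω t)
  rwa [ENNReal.toReal_add h1.1 h1.2, ENNReal.toReal_add h2.1 h2.2,
    ENNReal.toReal_add (by finiteness) (by finiteness)] at this

/-- A sequence of queues in the fluid regime: the data on which the fluid limit depends. -/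
structure IsFluidRegime (P : Measure Ω) (lamn Kn : ℕ → ℝ≥0 → ℝ) (theta mu : ℝ≥0 → ℝ)
    (A : ℕ → Ω → CountingPath) (R B : ℕ → ℕ → Ω → CountingPath) (Q : ℕ → ℝ≥0 → Ω → ℕ)
    (q₀ : ℝ) (lam k : ℝ≥0 → ℝ) : Prop where
  queue : ∀ n, 0 < n → IsQueue P (lamn n) theta mu (Kn n) (A n) (R n) (B n) (Q n)
  abandonment : IsPoissonFamily P R theta
  service : IsPoissonFamily P B mu
  staffing : IsStaffingLimit Kn k
  lam_integrable : LocIntegrable lam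
  lam_nonneg : ∀ t, 0 ≤ lam t
  initial : ∀ ε, 0 < ε → ∀ᶠ z in whp P, |(Q z.1 0 z.2 : ℝ) / z.1 - q₀| < ε
  arrival : ∀ t ε, 0 < ε →
    ∀ᶠ z in whp P, |(A z.1 z.2 t : ℝ) / z.1 - ∫ s in Iic t, lam s ∂leb| < ε

variable {lamn Kn : ℕ → ℝ≥0 → ℝ} {theta mu : ℝ≥0 → ℝ}
    {A : ℕ → Ω → CountingPath} {R B : ℕ → ℕ → Ω → CountingPath} {Q : ℕ → ℝ≥0 → Ω → ℕ}
    {q₀ : ℝ} {lam k : ℝ≥0 → ℝ}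

theorem IsFluidRegime.measurable_scaled
    (h : IsFluidRegime P lamn Kn theta mu A R B Q q₀ lam k) {z : ℕ × Ω} (hz : 0 < z.1) :
    Measurable (scaled Q z) :=
  (measurable_of_rightContinuous fun t => ((h.queue z.1 hz).cadlag z.2 t).1).div_const _

/-- The balance equation, rescaled. -/
theorem IsFluidRegime.eventually_balance
    (h : IsFluidRegime P lamn Kn theta mu A R B Q q₀ lam k) :
    ∀ᶠ z in whp P, 0 < z.1 ∧ ∀ t,
      thinned (fun i => R z.1 i z.2) (fun s => z.1 *
        (leftQ (Q z.1) z.2 s / z.1 - Function.leftLim (Kn z.1) s / z.1)) (Ioc 0 t) ≠ ∞ ∧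
      thinned (fun i => B z.1 i z.2) (fun s => z.1 *
        min (leftQ (Q z.1) z.2 s / z.1) (Function.leftLim (Kn z.1) s / z.1)) (Ioc 0 t) ≠ ∞ ∧
      scaled Q z t + (thinned (fun i => R z.1 i z.2) (fun s => z.1 *
        (leftQ (Q z.1) z.2 s / z.1 - Function.leftLim (Kn z.1) s / z.1)) (Ioc 0 t)).toReal / z.1 +
      (thinned (fun i => B z.1 i z.2) (fun s => z.1 *
        min (leftQ (Q z.1) z.2 s / z.1)
          (Function.leftLim (Kn z.1) s / z.1)) (Ioc 0 t)).toReal / z.1 =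
      scaled Q z 0 + (A z.1 z.2 t : ℝ) / z.1 := by
  refine eventually_whp_of_ae ?_
  filter_upwards [eventually_gt_atTop 0] with n hn
  filter_upwards [(h.queue n hn).ae_balance] with ω hω
  refine ⟨hn, fun t => ?_⟩
  obtain ⟨h1, h2, h3⟩ := hω t
  rw [← abandonments_eq_thinned _ _ _ _ _ hn, ← completions_eq_thinned _ _ _ _ _ hn]
  refine ⟨h1, h2, ?_⟩
  rw [scaled, scaled, ← add_div, ← add_div, ← add_div]
  rw [h3]

/-- Departures only lower the queue, so it stays below the initial value plus the arrivals by T;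
each of these is within 1/2 of its limit. -/
theorem IsFluidRegime.eventually_le
    (h : IsFluidRegime P lamn Kn theta mu A R B Q q₀ lam k) (T : ℝ≥0) :
    ∀ᶠ z in whp P, ∀ s ≤ T, 0 ≤ scaled Q z s ∧
      scaled Q z s ≤ |q₀| + (∫ s in Iic T, lam s ∂leb) + 1 := by
  filter_upwards [h.eventually_balance, h.initial (1 / 2) (by norm_num),
    h.arrival T (1 / 2) (by norm_num)] with z hb hi ha s hs
  obtain ⟨hz, hb⟩ := hb
  refine ⟨scaled_nonneg Q z s, ?_⟩
  have hA : (A z.1 z.2 s : ℝ) / z.1 ≤ (A z.1 z.2 T : ℝ) / z.1 := by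
    gcongr
    exact (A z.1 z.2).mono hs
  obtain ⟨-, -, h3⟩ := hb s
  have hi' : |scaled Q z 0 - q₀| < 1 / 2 := hi
  rw [abs_lt] at hi' ha
  have h4 : ∀ v : ℝ≥0∞, 0 ≤ v.toReal / z.1 := fun v => by positivity
  have := le_abs_self q₀
  linarith [h4 (thinned (fun i => R z.1 i z.2) (fun s => z.1 *
        (leftQ (Q z.1) z.2 s / z.1 - Function.leftLim (Kn z.1) s / z.1)) (Ioc 0 s)),
    h4 (thinned (fun i => B z.1 i z.2) (fun s => z.1 *
        min (leftQ (Q z.1) z.2 s / z.1) (Function.leftLim (Kn z.1) s / z.1)) (Ioc 0 s))]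

/-- The oscillation of the rescaled queue over an interval is controlled by the masses which the
rates put on this interval. -/
theorem IsFluidRegime.eventually_oscillation [IsProbabilityMeasure P]
    (h : IsFluidRegime P lamn Kn theta mu A R B Q q₀ lam k) {a b : ℝ≥0} (hab : a ≤ b) {M η : ℝ}
    (hη : 0 < η) (hM : ∀ᶠ z in whp P, ∀ s ≤ b, 0 ≤ scaled Q z s ∧ scaled Q z s ≤ M) :
    ∀ᶠ z in whp P, ∀ s ∈ Icc a b, |scaled Q z s - scaled Q z a| ≤
      (rateMeasure lam (Ioc a b)).toReal + M * (rateMeasure theta (Ioc a b)).toReal +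
        M * (rateMeasure mu (Ioc a b)).toReal + η := by
  have hM0 : 0 ≤ M := by
    obtain ⟨z, hz⟩ := hM.exists
    exact (hz 0 zero_le).1.trans (hz 0 zero_le).2
  have hη2 : 0 < η / 2 := by positivity
  have hlamfin := rateMeasure_Iic_ne_top h.lam_integrable h.lam_nonneg
  have hlam : ∀ t, (rateMeasure lam (Iic t)).toReal = ∫ s in Iic t, lam s ∂leb := fun t => by
    rw [rateMeasure_apply_eq h.lam_integrable h.lam_nonneg measurableSet_Iic subset_rfl,
      ENNReal.toReal_ofReal (integral_nonneg h.lam_nonneg)]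
  have hconst : ∀ {r : ℝ≥0 → ℝ}, ∫ s in Ioc a b, max M 0 ∂(rateMeasure r) =
      M * (rateMeasure r (Ioc a b)).toReal := fun {r} => by
    rw [max_eq_left hM0, setIntegral_const, smul_eq_mul, mul_comm]
    rfl
  -- A rise is bounded by the arrivals (errors at a and b), a fall by the two families run at the
  -- constant level M (one error each). Either way two errors η / 2 occur.
  filter_upwards [h.eventually_balance, hM, h.arrival a _ hη2, h.arrival b _ hη2,
    h.abandonment.eventually_thinned_const h.staffing isSelection_fst a b M hη2,
    h.service.eventually_thinned_const h.staffing isSelection_fst a b M hη2] with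
    z hb hM hAa hAb hR hB s hs
  obtain ⟨hz, hb⟩ := hb
  have hz' : (0 : ℝ) < z.1 := by exact_mod_cast hz
  rw [hconst, abs_lt] at hR hB
  rw [← hlam, abs_lt] at hAa hAb
  rw [measure_Ioc_toReal hlamfin hab]
  have hleft : ∀ u ∈ Ioc a s, leftQ (Q z.1) z.2 u / z.1 ≤ M := fun u hu =>
    leftQ_div_mem (C := Iic M) isClosed_Iic hu.1 fun v hv =>
      (hM v (hv.2.trans (hu.2.trans hs.2))).2
  have hK : ∀ u, 0 ≤ Function.leftLim (Kn z.1) u / z.1 := fun u =>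
    div_nonneg (leftLim_nonneg (h.staffing.staffing z.1 hz).nonneg u) hz'.le
  -- Departures in (a, s] are dominated by the counts at level M on all of (a, b], a bound that does
  -- not depend on s.
  have key : ∀ (φ : ℝ → ℝ → ℝ), IsSelection φ → ∀ N : ℕ → CountingPath,
      thinned N (fun u => z.1 * φ (leftQ (Q z.1) z.2 u / z.1)
        (Function.leftLim (Kn z.1) u / z.1)) (Ioc 0 s) ≠ ∞ →
      (thinned N (fun u => z.1 * φ (leftQ (Q z.1) z.2 u / z.1)
        (Function.leftLim (Kn z.1) u / z.1)) (Ioc 0 a)).toReal / z.1 ≤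
      (thinned N (fun u => z.1 * φ (leftQ (Q z.1) z.2 u / z.1)
        (Function.leftLim (Kn z.1) u / z.1)) (Ioc 0 s)).toReal / z.1 ∧
      (thinned N (fun u => z.1 * φ (leftQ (Q z.1) z.2 u / z.1)
        (Function.leftLim (Kn z.1) u / z.1)) (Ioc 0 s)).toReal / z.1 ≤
      (thinned N (fun u => z.1 * φ (leftQ (Q z.1) z.2 u / z.1)
        (Function.leftLim (Kn z.1) u / z.1)) (Ioc 0 a)).toReal / z.1 +
      (thinned N (fun _ => z.1 * M) (Ioc a b)).toReal / z.1 := by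
    intro φ hφ N hfin
    have hun := thinned_union N (fun u => z.1 * φ (leftQ (Q z.1) z.2 u / z.1)
      (Function.leftLim (Kn z.1) u / z.1)) (zero_le (a := a)) hs.1
    rw [hun] at hfin ⊢
    obtain ⟨hf1, hf2⟩ := ENNReal.add_ne_top.1 hfin
    rw [ENNReal.toReal_add hf1 hf2, add_div]
    refine ⟨le_add_of_nonneg_right (by positivity), ?_⟩
    gcongr
    · exact thinned_ne_top N fun _ _ => le_rfl
    · refine (thinned_mono N (h' := fun _ => z.1 * M) fun u hu => ?_).trans ?_
      · gcongr
        exact (hφ.le _ _ (hK u)).trans (hleft u hu)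
      · exact ENNReal.tsum_le_tsum fun i =>
          measure_mono (inter_subset_inter_left _ (Ioc_subset_Ioc_right hs.2))
  obtain ⟨hs1, hs2, hs3⟩ := hb s
  obtain ⟨-, -, ha3⟩ := hb a
  have k1 := key _ isSelection_sub _ hs1
  have k2 := key _ isSelection_min _ hs2
  have m1 : (A z.1 z.2 a : ℝ) / z.1 ≤ (A z.1 z.2 s : ℝ) / z.1 := by
    gcongr
    exact (A z.1 z.2).mono hs.1
  have m2 : (A z.1 z.2 s : ℝ) / z.1 ≤ (A z.1 z.2 b : ℝ) / z.1 := by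
    gcongr
    exact (A z.1 z.2).mono hs.2
  have p1 : 0 ≤ M * (rateMeasure theta (Ioc a b)).toReal := by positivity
  have p2 : 0 ≤ M * (rateMeasure mu (Ioc a b)).toReal := by positivity
  have p3 : 0 ≤ (rateMeasure lam (Iic b)).toReal - (rateMeasure lam (Iic a)).toReal := by
    rw [← measure_Ioc_toReal hlamfin hab]
    positivity
  rw [abs_le]
  constructor <;> linarith [k1.1, k1.2, k2.1, k2.2, hR.2, hB.2, hAa.1, hAb.2]

end Queue

/-! ### The residual of the rescaled queue in the fluid equation -/

section Queue

variable {Ω : Type*} [MeasurableSpace Ω] {P : Measure Ω}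
  {lamn Kn : ℕ → ℝ≥0 → ℝ} {theta mu : ℝ≥0 → ℝ}
  {A : ℕ → Ω → CountingPath} {R B : ℕ → ℕ → Ω → CountingPath} {Q : ℕ → ℝ≥0 → Ω → ℕ}
  {q₀ : ℝ} {lam k : ℝ≥0 → ℝ}

theorem setIntegral_Iic_eq_rateMeasure {r : ℝ≥0 → ℝ} (hr : LocIntegrable r) (hr0 : ∀ t, 0 ≤ r t)
    (f : ℝ≥0 → ℝ) (t : ℝ≥0) :
    ∫ s in Iic t, r s * f s ∂leb = ∫ s in Ioc 0 t, f s ∂(rateMeasure r) := by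
  rw [← setIntegral_rateMeasure hr hr0 f measurableSet_Iic, restrict_Iic_eq_restrict_Ioc]

/-- The fluid map in terms of the measures `λ_s ds`, `θ_s ds` and `μ_s ds`. -/
theorem fluidMap_eq (htheta0 : ∀ t, 0 ≤ theta t) (htheta : LocIntegrable theta)
    (hmu0 : ∀ t, 0 ≤ mu t) (hmu : LocIntegrable mu) (hlam0 : ∀ t, 0 ≤ lam t)
    (hlam : LocIntegrable lam) (hk : ∀ t, 0 ≤ k t) {x : ℝ≥0 → ℝ} (hx : ∀ t, 0 ≤ x t) (t : ℝ≥0) :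
    fluidMap q₀ lam theta mu k x t = q₀ + (rateMeasure lam (Iic t)).toReal
      - (∫ s in Ioc 0 t, max (x s - k s) 0 ∂(rateMeasure theta))
      - ∫ s in Ioc 0 t, max (min (x s) (k s)) 0 ∂(rateMeasure mu) := by
  rw [fluidMap, setIntegral_Iic_eq_rateMeasure htheta htheta0,
    setIntegral_Iic_eq_rateMeasure hmu hmu0,
    rateMeasure_apply_eq hlam hlam0 measurableSet_Iic subset_rfl,
    ENNReal.toReal_ofReal (integral_nonneg hlam0)]
  congr 1
  refine integral_congr_ae (ae_of_all _ fun s => ?_)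
  exact (max_eq_left (le_min (hx s) (hk s))).symm

/-- The rescaled queue solves the fluid equation up to a small error, uniformly on bounded
intervals, with high probability. -/
theorem IsFluidRegime.eventually_residual_le [IsProbabilityMeasure P]
    (h : IsFluidRegime P lamn Kn theta mu A R B Q q₀ lam k) (T : ℝ≥0) {ε : ℝ} (hε : 0 < ε) :
    ∀ᶠ z in whp P, ∀ t ≤ T,
      |scaled Q z t - fluidMap q₀ lam theta mu k (scaled Q z) t| ≤ ε := by
  have htheta := h.abandonment.integrable
  have htheta0 := h.abandonment.nonneg
  have hmu := h.service.integrable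
  have hmu0 := h.service.nonneg
  have hk := h.staffing.limit
  have fl := rateMeasure_Iic_ne_top h.lam_integrable h.lam_nonneg
  have ft := rateMeasure_Iic_ne_top htheta htheta0
  have fm := rateMeasure_Iic_ne_top hmu hmu0
  have hlam : ∀ t, (rateMeasure lam (Iic t)).toReal = ∫ s in Iic t, lam s ∂leb := fun t => by
    rw [rateMeasure_apply_eq h.lam_integrable h.lam_nonneg measurableSet_Iic subset_rfl,
      ENNReal.toReal_ofReal (integral_nonneg h.lam_nonneg)]
  set M : ℝ := |q₀| + (∫ s in Iic T, lam s ∂leb) + 1 with hMdef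
  have hM0 : 0 < M := by
    rw [hMdef, ← hlam]
    positivity
  have hxM := h.eventually_le T
  set ρ : Measure ℝ≥0 := rateMeasure lam + (rateMeasure theta + rateMeasure mu) with hρ
  have : NullSingletonClass ρ := ⟨fun x => by simp [hρ]⟩
  have fρ : ∀ t, ρ (Iic t) ≠ ∞ := fun t => by
    rw [hρ, Measure.add_apply, Measure.add_apply]
    finiteness [fl t, ft t, fm t]
  set V : ℝ := (rateMeasure theta (Iic T)).toReal + (rateMeasure mu (Iic T)).toReal with hV
  have hV0 : 0 ≤ V := by positivity
  -- Chosen so that 6 V δ for the compensators and 2 δ for the motion within a cell add up to ε / 2.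
  set δ : ℝ := ε / (4 * (1 + 3 * V)) with hδ
  have hδ0 : 0 < δ := by positivity
  have hδV : (2 + 6 * V) * δ = ε / 2 := by
    rw [hδ]
    field_simp
    ring
  -- With this total mass per cell, the weights 1, M, M of the oscillation bound give at most δ / 2;
  -- the other half of δ is for the random error.
  have hδ'0 : 0 < δ / (2 * (M + 1)) := by positivity
  have hδ' : (1 + M) * (δ / (2 * (M + 1))) = δ / 2 := by
    field_simp
    ring
  obtain ⟨m, τ, hτ, hτ0, hτm, hmass⟩ := exists_partition ρ fρ T hδ'0
  have hmass' : ∀ j < m, (rateMeasure lam (Ioc (τ j) (τ (j + 1)))).toReal +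
      M * (rateMeasure theta (Ioc (τ j) (τ (j + 1)))).toReal +
      M * (rateMeasure mu (Ioc (τ j) (τ (j + 1)))).toReal ≤ δ / 2 := fun j hj => by
    have h1 := hmass j hj
    have f1 := measure_ne_top_of_subset (Ioc_subset_Iic_self (a := τ j)) (fl (τ (j + 1)))
    have f2 := measure_ne_top_of_subset (Ioc_subset_Iic_self (a := τ j)) (ft (τ (j + 1)))
    have f3 := measure_ne_top_of_subset (Ioc_subset_Iic_self (a := τ j)) (fm (τ (j + 1)))
    rw [hρ, Measure.add_apply, Measure.add_apply, ENNReal.toReal_add f1 (by finiteness),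
      ENNReal.toReal_add f2 f3] at h1
    set u := (rateMeasure lam (Ioc (τ j) (τ (j + 1)))).toReal with hu
    set v := (rateMeasure theta (Ioc (τ j) (τ (j + 1)))).toReal with hv
    set w := (rateMeasure mu (Ioc (τ j) (τ (j + 1)))).toReal with hw
    have hu0 : 0 ≤ u := ENNReal.toReal_nonneg
    have hv0 : 0 ≤ v := ENNReal.toReal_nonneg
    have hw0 : 0 ≤ w := ENNReal.toReal_nonneg
    have h2 := mul_le_mul_of_nonneg_left h1 (show 0 ≤ 1 + M by positivity)
    rw [hδ'] at h2
    have h3 := mul_nonneg hM0.le hu0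
    linarith
  have hosc0 : ∀ j < m, ∀ᶠ z in whp P, ∀ s ∈ Icc (τ j) (τ (j + 1)),
      |scaled Q z s - scaled Q z (τ j)| ≤ δ := fun j hj => by
    have hjT : τ (j + 1) ≤ T := hτm ▸ hτ hj
    filter_upwards [h.eventually_oscillation (hτ j.le_succ) (half_pos hδ0)
      (hxM.mono fun z hz s hs => hz s (hs.trans hjT))] with z hz s hs
    have := hz s hs
    have := hmass' j hj
    linarith
  have hosc : ∀ j < m, ∀ᶠ z in whp P, ∀ s ∈ Ioc (τ j) (τ (j + 1)),
      |scaled Q z s - scaled Q z (τ j)| ≤ δ ∧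
      |leftQ (Q z.1) z.2 s / z.1 - scaled Q z (τ j)| ≤ δ := fun j hj => by
    filter_upwards [hosc0 j hj] with z hz s hs
    refine ⟨hz s ⟨hs.1.le, hs.2⟩, ?_⟩
    exact leftQ_div_mem (C := {v | |v - scaled Q z (τ j)| ≤ δ})
      (isClosed_le (by fun_prop) continuous_const) hs.1
      fun u hu => hz u ⟨hu.1.le, hu.2.trans hs.2⟩
  have hbal := h.eventually_balance
  have hmeas : ∀ᶠ z in whp P, AEMeasurable (scaled Q z) leb :=
    hbal.mono fun z hz => (h.measurable_scaled hz.1).aemeasurable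
  set η : ℝ := ε / (16 * (m + 1)) with hη
  have hη0 : 0 < η := by positivity
  have hmη : m * η ≤ ε / 16 := by
    rw [hη, mul_div_assoc', div_le_div_iff₀ (by positivity) (by positivity)]
    nlinarith
  have hR := h.abandonment.eventually_compensator h.staffing isSelection_sub
    (xl := fun z s => leftQ (Q z.1) z.2 s / z.1) hτ hτ0 hδ0 hη0 hmeas
    (by rw [hτm]; exact hxM) hosc (hbal.mono fun z hz => (hz.2 _).1)
  have hB := h.service.eventually_compensator h.staffing isSelection_min
    (xl := fun z s => leftQ (Q z.1) z.2 s / z.1) hτ hτ0 hδ0 hη0 hmeas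
    (by rw [hτm]; exact hxM) hosc (hbal.mono fun z hz => (hz.2 _).2.1)
  rw [hτm] at hR hB
  have hA : ∀ᶠ z in whp P, ∀ j ∈ Finset.range (m + 1),
      |(A z.1 z.2 (τ j) : ℝ) / z.1 - ∫ s in Iic (τ j), lam s ∂leb| < ε / 8 := by
    rw [eventually_all_finset]
    exact fun j _ => h.arrival (τ j) _ (by positivity)
  have hoscall : ∀ᶠ z in whp P, ∀ j ∈ Finset.range m, ∀ s ∈ Icc (τ j) (τ (j + 1)),
      |scaled Q z s - scaled Q z (τ j)| ≤ δ := by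
    rw [eventually_all_finset]
    exact fun j hj => hosc0 j (Finset.mem_range.1 hj)
  filter_upwards [hbal, hmeas, hxM, hR, hB, hA, hoscall, h.initial (ε / 8) (by positivity)] with
    z hbal hmeas hxM hR hB hA hosc hinit
  have hfluid := fluidMap_eq (q₀ := q₀) htheta0 htheta hmu0 hmu h.lam_nonneg h.lam_integrable
    hk.nonneg (scaled_nonneg Q z)
  -- The part 3/8 ε consists of ε / 8 each for the initial value, the arrivals, and the two sums m η
  -- ≤ ε / 16. The compensators need only 3 δ V.
  have hgrid : ∀ j ≤ m, |scaled Q z (τ j) - fluidMap q₀ lam theta mu k (scaled Q z) (τ j)| ≤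
      6 * δ * V + 3 / 8 * ε := fun j hj => by
    have h1 := abs_le.1 (hR j hj)
    have h2 := abs_le.1 (hB j hj)
    have h3 := hA j (Finset.mem_range.2 (by omega))
    rw [← hlam] at h3
    have h3 := abs_lt.1 h3
    have h4 : |scaled Q z 0 - q₀| < ε / 8 := hinit
    have h4 := abs_lt.1 h4
    have h5 := (hbal.2 (τ j)).2.2
    have h6 : 0 ≤ 3 * δ * V := by positivity
    rw [hfluid, abs_le]
    constructor <;> linarith
  -- Between grid times the fluid map moves no more than the cell masses allow, by the bound M on
  -- the path.
  have hstep : ∀ j < m, ∀ t ∈ Ioc (τ j) (τ (j + 1)),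
      |fluidMap q₀ lam theta mu k (scaled Q z) t -
        fluidMap q₀ lam theta mu k (scaled Q z) (τ j)| ≤ δ := by
    intro j hj t ht
    have htT : t ≤ T := ht.2.trans (hτm ▸ hτ hj)
    have hinc : ∀ {φ : ℝ → ℝ → ℝ}, IsSelection φ → ∀ {r : ℝ≥0 → ℝ} (hr : LocIntegrable r)
        (hr0 : ∀ t, 0 ≤ r t), ∃ d : ℝ, 0 ≤ d ∧
        d ≤ M * (rateMeasure r (Ioc (τ j) (τ (j + 1)))).toReal ∧
        ∫ s in Ioc 0 t, max (φ (scaled Q z s) (k s)) 0 ∂(rateMeasure r) =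
        (∫ s in Ioc 0 (τ j), max (φ (scaled Q z s) (k s)) 0 ∂(rateMeasure r)) + d := by
      intro φ hφ r hr hr0
      have hint : ∀ a b : ℝ≥0, b ≤ T → IntegrableOn (fun s => max (φ (scaled Q z s) (k s)) 0)
          (Ioc a b) (rateMeasure r) := fun a b hb =>
        hφ.integrableOn hr hr0 hk hmeas measurableSet_Ioc
          Ioc_subset_Iic_self (M := M) fun s hs => (hxM s (hs.2.trans hb)).2
      refine ⟨∫ s in Ioc (τ j) t, max (φ (scaled Q z s) (k s)) 0 ∂(rateMeasure r),
        integral_nonneg fun s => le_max_right _ _, ?_, ?_⟩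
      · refine (hφ.setIntegral_le hr hr0 hk hmeas hM0.le
          fun s hs => (hxM s (hs.2.trans htT)).2).trans ?_
        gcongr
        · exact measure_ne_top_of_subset Ioc_subset_Iic_self (rateMeasure_Iic_ne_top hr hr0 _)
        · exact ht.2
      · rw [← Ioc_union_Ioc_eq_Ioc zero_le ht.1.le]
        exact setIntegral_union (Ioc_disjoint_Ioc_of_le le_rfl) measurableSet_Ioc
          (hint _ _ (ht.1.le.trans htT)) (hint _ _ htT)
    obtain ⟨d1, h1, h1', e1⟩ := hinc isSelection_sub htheta htheta0
    obtain ⟨d2, h2, h2', e2⟩ := hinc isSelection_min hmu hmu0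
    have h3 := measure_Ioc_toReal fl ht.1.le
    have h4 : (rateMeasure lam (Ioc (τ j) t)).toReal ≤
        (rateMeasure lam (Ioc (τ j) (τ (j + 1)))).toReal := by
      gcongr
      · exact measure_ne_top_of_subset Ioc_subset_Iic_self (fl _)
      · exact ht.2
    have h5 : 0 ≤ (rateMeasure lam (Ioc (τ j) t)).toReal := ENNReal.toReal_nonneg
    have h6 := hmass' j hj
    rw [hfluid, hfluid, e1, e2, abs_le]
    constructor <;> linarith
  intro t ht
  have htotal : 6 * δ * V + 3 / 8 * ε + 2 * δ ≤ ε := by linarith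
  rcases exists_mem_Ioc_of_monotone m (ht.trans_eq hτm.symm) with ht0 | ⟨j, hj, hjt⟩
  · have : t = τ 0 := le_antisymm ht0 (hτ0 ▸ zero_le)
    rw [this]
    linarith [hgrid 0 (zero_le)]
  · have h1 := abs_le.1 (hgrid j hj.le)
    have h2 := abs_le.1 (hstep j hj t hjt)
    have h3 := abs_le.1 (hosc j (Finset.mem_range.2 hj) t ⟨hjt.1.le, hjt.2⟩)
    rw [abs_le]
    constructor <;> linarith

/-- The bound depends on the path, unlike that of `eventually_le`, but one event serves all t at
once, as admissibility demands. -/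
theorem IsFluidRegime.eventually_locallyBounded
    (h : IsFluidRegime P lamn Kn theta mu A R B Q q₀ lam k) :
    ∀ᶠ z in whp P, ∀ t, ∃ b, ∀ s ≤ t, |scaled Q z s| ≤ b := by
  filter_upwards [h.eventually_balance] with z hz t
  refine ⟨scaled Q z 0 + (A z.1 z.2 t : ℝ) / z.1, fun s hs => ?_⟩
  rw [abs_of_nonneg (scaled_nonneg Q z s)]
  have hA : (A z.1 z.2 s : ℝ) / z.1 ≤ (A z.1 z.2 t : ℝ) / z.1 := by
    gcongr
    exact (A z.1 z.2).mono hs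
  have h4 : ∀ v : ℝ≥0∞, 0 ≤ v.toReal / z.1 := fun v => by positivity
  have h5 := (hz.2 s).2.2
  linarith [h4 (thinned (fun i => R z.1 i z.2) (fun s => z.1 *
        (leftQ (Q z.1) z.2 s / z.1 - Function.leftLim (Kn z.1) s / z.1)) (Ioc 0 s)),
    h4 (thinned (fun i => B z.1 i z.2) (fun s => z.1 *
        min (leftQ (Q z.1) z.2 s / z.1) (Function.leftLim (Kn z.1) s / z.1)) (Ioc 0 s))]

/-- A path of the rescaled queue provides an approximate solution of the fluid equation. -/
theorem IsFluidRegime.exists_isFluidSolution [IsProbabilityMeasure P]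
    (h : IsFluidRegime P lamn Kn theta mu A R B Q q₀ lam k) :
    ∃ q, IsFluidSolution q₀ lam theta mu k q := by
  refine FluidQueue.exists_isFluidSolution h.abandonment.nonneg h.abandonment.integrable
    h.service.nonneg h.service.integrable h.staffing.limit fun T ε hε => ?_
  obtain ⟨z, hz, hb, hr⟩ := (eventually_whp_pos.and
    (h.eventually_locallyBounded.and (h.eventually_residual_le T hε))).exists
  exact ⟨scaled Q z, h.measurable_scaled hz, hb, hr⟩

/-- Since q has zero residual, stability turns a residual ε / (C + 1) of the queue into a distance
of at most ε; the added 1 covers C = 0. -/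
theorem IsFluidRegime.eventually_abs_sub_le [IsProbabilityMeasure P]
    (h : IsFluidRegime P lamn Kn theta mu A R B Q q₀ lam k) {q : ℝ≥0 → ℝ}
    (hq : IsFluidSolution q₀ lam theta mu k q) (T : ℝ≥0) {ε : ℝ} (hε : 0 < ε) :
    ∀ᶠ z in whp P, ∀ t ≤ T, |scaled Q z t - q t| ≤ ε := by
  obtain ⟨C, hC0, hC⟩ := exists_fluid_stability_const (q₀ := q₀) (lam := lam) (k := k)
    h.abandonment.nonneg h.abandonment.integrable h.service.nonneg h.service.integrable T
  obtain ⟨b', hb'⟩ := hq.locallyBounded h.lam_integrable T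
  have hε' : 0 < ε / (C + 1) := by positivity
  filter_upwards [eventually_whp_pos, h.eventually_locallyBounded,
    h.eventually_residual_le T hε'] with z hz hb hr t ht
  obtain ⟨b, hb0⟩ := hb T
  refine (hC (scaled Q z) q (ε / (C + 1)) (b + b') (.of_locallyBounded h.abandonment.integrable
    h.service.integrable h.staffing.limit (h.measurable_scaled hz).aemeasurable hb)
    hq.isAdmissible (fun s hs => (abs_sub _ _).trans (add_le_add (hb0 s hs) (hb' s hs)))
    (fun s hs => ?_) t ht).trans ?_
  · rw [← hq.eq_fluidMap, sub_self, abs_zero, add_zero]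
    exact hr s hs
  · rw [mul_div_assoc', div_le_iff₀ (by positivity)]
    linarith

end Queue

end FluidQueue

/-! ### The fluid limit -/

theorem theorem1 {Ω : Type*} [MeasurableSpace Ω] (P : Measure Ω) [IsProbabilityMeasure P]
    -- the data of the queues, indexed by `n ≥ 1`
    (lamn Kn : ℕ → ℝ≥0 → ℝ) (theta mu : ℝ≥0 → ℝ)
    (A : ℕ → Ω → FluidQueue.CountingPath) (R B : ℕ → ℕ → Ω → FluidQueue.CountingPath)
    (Q : ℕ → ℝ≥0 → Ω → ℕ)
    (hlamn_nonneg : ∀ n, 0 < n → ∀ t, 0 ≤ lamn n t)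
    (hlamn : ∀ n, 0 < n → FluidQueue.LocIntegrable (lamn n))
    (htheta_nonneg : ∀ t, 0 ≤ theta t) (htheta : FluidQueue.LocIntegrable theta)
    (hmu_nonneg : ∀ t, 0 ≤ mu t) (hmu : FluidQueue.LocIntegrable mu)
    (hKn : ∀ n, 0 < n → FluidQueue.IsStaffing (Kn n))
    (hQ : ∀ n, 0 < n →
      FluidQueue.IsQueue P (lamn n) theta mu (Kn n) (A n) (R n) (B n) (Q n))
    -- the data of the limit
    (q₀ : ℝ) (lam k : ℝ≥0 → ℝ)
    (hlam_nonneg : ∀ t, 0 ≤ lam t) (hlam : FluidQueue.LocIntegrable lam)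
    (hk : FluidQueue.IsStaffing k)
    -- the convergence hypotheses
    (hQ0_lim : TendstoInMeasure P (fun (n : ℕ) ω => (Q n 0 ω : ℝ) / n) atTop (fun _ => q₀))
    (hlam_lim : ∀ t, Tendsto (fun n : ℕ => ∫ s in Iic t, lamn n s / n ∂FluidQueue.leb) atTop
      (𝓝 (∫ s in Iic t, lam s ∂FluidQueue.leb)))
    (hK_lim : ∀ T, TendstoUniformlyOn (fun (n : ℕ) t => Kn n t / n) k atTop (Iic T)) :
    ∃ q : ℝ≥0 → ℝ,
      FluidQueue.IsFluidSolution q₀ lam theta mu k q ∧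
      (∀ q' : ℝ≥0 → ℝ, FluidQueue.IsFluidSolution q₀ lam theta mu k q' → q' = q) ∧
      ∀ (T : ℝ≥0) (ε : ℝ), 0 < ε →
        Tendsto (fun n : ℕ =>
            P {ω | ENNReal.ofReal ε <
              ⨆ t ∈ Iic T, ENNReal.ofReal |(Q n t ω : ℝ) / n - q t|})
          atTop (𝓝 0) := by
  have hregime : FluidQueue.IsFluidRegime P lamn Kn theta mu A R B Q q₀ lam k :=
    { queue := hQ
      abandonment :=
        { integrable := htheta
          nonneg := htheta_nonneg
          poisson := fun n hn => (hQ n hn).abandonment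
          indep := fun n hn i j hij => (hQ n hn).indep.indep
            (i := .abandonment i) (j := .abandonment j) (by simpa using hij) }
      service :=
        { integrable := hmu
          nonneg := hmu_nonneg
          poisson := fun n hn => (hQ n hn).service
          indep := fun n hn i j hij => (hQ n hn).indep.indep
            (i := .service i) (j := .service j) (by simpa using hij) }
      staffing :=
        { staffing := hKn
          limit := hk
          tendsto := fun t => (hK_lim t).tendsto_at self_mem_Iic }
      lam_integrable := hlam
      lam_nonneg := hlam_nonneg
      initial := fun ε hε => by
        rw [FluidQueue.eventually_whp_iff]
        have h := tendstoInMeasure_iff_dist.1 hQ0_lim ε hε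
        simpa only [not_lt, Real.dist_eq] using h
      arrival := fun t ε hε => FluidQueue.counting_law_of_large_numbers hlamn hlamn_nonneg
        (fun n hn => (hQ n hn).arrival) (hlam_lim t) hε }
  obtain ⟨q, hq⟩ := hregime.exists_isFluidSolution
  refine ⟨q, hq, fun q' hq' => hq.unique hlam htheta_nonneg htheta hmu_nonneg hmu hq',
    fun T ε hε => ?_⟩
  refine tendsto_of_tendsto_of_tendsto_of_le_of_le tendsto_const_nhds
    (FluidQueue.eventually_whp_iff.1 (hregime.eventually_abs_sub_le hq T hε))
    (fun _ => zero_le) fun n => measure_mono fun ω hω h => ?_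
  -- The supremum is taken in `ℝ≥0∞`, so the pointwise bound on [0, T] passes to it with no
  -- boundedness to check.
  exact absurd (iSup₂_le fun t ht => ENNReal.ofReal_le_ofReal (h t ht)) (not_le.2 hω)
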